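/- **Conventions.** A TDLC group is a Hausdorff, totally disconnected, locally compact topological group. Let $G$ be a TDLC group and $\mathcal H$ a finite collection of open subgroups of $G$. - $G$ is *compactly generated relative to* $\mathcal H$ if there is a compact set $K\subseteq G$ such that $K\cup\bigcup_{H\in\mathcal H}H$ generates $G$ algebraically. - $(G,\mathcal H)$ is a *proper pair* if no two distinct non-compact members of $\mathcal H$ are conjugate in $G$. - For a proper pair $(G,\mathcal H)$, a *Cayley–Abels graph of $G$ with respect to $\mathcal H$* is a connected simplicial graph $X$ on which $G$ acts by automorphisms with finitely many orbits of vertices and edges and with open vertex stabilizers, such that: (1) edge stabilizers are compact; (2) every vertex stabilizer is compact or conjugate to a member of $\mathcal H$; (3) every $H\in\mathcal H$ is the stabilizer of some vertex; (4) if $H\in\mathcal H$ is non-compact, any two vertices with stabilizer equal to $H$ lie in the same $G$-orbit. - A graph is *fine* if for all vertices $u,v$ and all $n\in\mathbb N$ there are only finitely many embedded paths of length $n$ from $u$ to $v$. A connected graph is *hyperbolic* if, with edges of length one, it is a Gromov hyperbolic metric space. - $G$ is *hyperbolic relative to* $\mathcal H$ if $(G,\mathcal H)$ is a proper pair and some Cayley–Abels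 graph of $G$ with respect to $\mathcal H$ is fine and hyperbolic. **Theorem 1.1.** Let $A$ and $B$ be TDLC groups which are compactly generated relative to finite collections of open subgroups $\mathcal H_A$ and $\mathcal H_B$, respectively. Let $C$ be a compact topological group, and let $i_A:C\to A$ and $i_B:C\to B$ be injective homomorphisms that are topological isomorphisms onto open subgroups of $A$ and $B$, respectively. Let $G=A\ast_C B$ be the amalgamated free product along $i_A$ and $i_B$, with the unique group topology for which $A\to G$ and $B\to G$ are topological isomorphisms onto open subgroups of $G$. If $A$ is hyperbolic relative to $\mathcal H_A$ and $B$ is hyperbolic relative to $\mathcal H_B$, then $G$ is a TDLC group which is hyperbolic relative to $\mathcal H_A\cup\mathcal H_B$, where the members of $\mathcal H_A$ and $\mathcal H_B$ are regarded as subgroups of $G$ through $A\to G$ and $B\to G$. -/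

import Mathlib

universe u v

namespace TDLC

/-- A TDLC group: a Hausdorff topological group that is locally compact and totally disconnected. -/
structure IsTDLC (G : Type u) [Group G] [TopologicalSpace G] : Prop where
  isTopologicalGroup : IsTopologicalGroup G
  t2Space : T2Space G
  locallyCompactSpace : LocallyCompactSpace G
  totallyDisconnectedSpace : TotallyDisconnectedSpace G

/-- `K` and `L` are conjugate subgroups: `L = g K g⁻¹` for some `g`. -/
def IsConjSubgroup {G : Type u} [Group G] (K L : Subgroup G) : Prop :=
  ∃ g : G, L = K.map (MulAut.conj g).toMonoidHom

/-- A proper pair `(G, ℋ)`: a TDLC group `G` with a finite collection `ℋ` of open subgroups, no two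
distinct non-compact members of which are conjugate in `G`. -/
structure IsProperPair {G : Type u} [Group G] [TopologicalSpace G]
    (ℋ : Set (Subgroup G)) : Prop where
  isTDLC : IsTDLC G
  finite : ℋ.Finite
  isOpen : ∀ K ∈ ℋ, IsOpen (K : Set G)
  eq_of_conj : ∀ K ∈ ℋ, ∀ L ∈ ℋ, ¬ IsCompact (K : Set G) → ¬ IsCompact (L : Set G) →
    IsConjSubgroup K L → K = L

/-- `G` is compactly generated relative to `ℋ`: some compact set together with the members of `ℋ`
generates `G` algebraically. -/
def IsCompactlyGeneratedRel {G : Type u} [Group G] [TopologicalSpace G]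
    (ℋ : Set (Subgroup G)) : Prop :=
  ∃ K : Set G, IsCompact K ∧ Subgroup.closure (K ∪ ⋃ L ∈ ℋ, (L : Set G)) = ⊤

/-- The setwise stabilizer of the pair `{x, y}`. -/
def edgeStabilizer (G : Type u) [Group G] {V : Type v} [MulAction G V] (x y : V) : Set G :=
  {g | s(g • x, g • y) = s(x, y)}

/-- `X` is a Cayley-Abels graph of `G` with respect to `ℋ`: a connected simplicial graph on which
`G` acts by automorphisms, cocompactly (finitely many orbits of vertices and of edges), discretely
(vertex stabilizers are open, hence so are the pointwise stabilizers of edges, which are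
intersections of two vertex stabilizers), and with the four defining properties on stabilizers. -/
structure IsCayleyAbelsGraph {G : Type u} [Group G] [TopologicalSpace G] (ℋ : Set (Subgroup G))
    {V : Type v} [MulAction G V] (X : SimpleGraph V) : Prop where
  adj_smul : ∀ (g : G) (x y : V), X.Adj x y → X.Adj (g • x) (g • y)
  connected : X.Connected
  finite_vertex_orbits : ∃ F : Set V, F.Finite ∧ ∀ x : V, ∃ g : G, g • x ∈ F
  finite_edge_orbits : ∃ F : Set (V × V), F.Finite ∧
    ∀ x y : V, X.Adj x y → ∃ g : G, (g • x, g • y) ∈ F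
  isOpen_stabilizer : ∀ x : V, IsOpen (MulAction.stabilizer G x : Set G)
  isCompact_edge : ∀ x y : V, X.Adj x y → IsCompact (edgeStabilizer G x y)
  vertex_stabilizer : ∀ x : V, IsCompact (MulAction.stabilizer G x : Set G) ∨
    ∃ K ∈ ℋ, IsConjSubgroup K (MulAction.stabilizer G x)
  exists_vertex : ∀ K ∈ ℋ, ∃ x : V, MulAction.stabilizer G x = K
  same_orbit : ∀ K ∈ ℋ, ¬ IsCompact (K : Set G) → ∀ x y : V,
    MulAction.stabilizer G x = K → MulAction.stabilizer G y = K → ∃ g : G, g • x = y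

/-- A graph is fine if for all vertices `x`, `y` and all `n` there are only finitely many embedded
paths of length `n` from `x` to `y`. -/
def IsFine {V : Type v} (X : SimpleGraph V) : Prop :=
  ∀ (x y : V) (n : ℕ), {p : X.Walk x y | p.IsPath ∧ p.length = n}.Finite

/-- Gromov hyperbolicity of a connected graph with edges of length one, by Gromov's four-point
inequality for the path metric on the vertex set. (Every point of the geometric realization is at
distance at most `1 / 2` from a vertex, so the inequality holds for some constant on the vertices
if and only if it does on the geometric realization.) -/
def IsHyperbolicGraph {V : Type v} (X : SimpleGraph V) : Prop :=
  ∃ δ : ℕ, ∀ x y z t : V,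
    X.dist x y + X.dist z t ≤ max (X.dist x z + X.dist y t) (X.dist x t + X.dist y z) + δ

/-- `G` is hyperbolic relative to `ℋ`: `(G, ℋ)` is a proper pair and some Cayley-Abels graph of
`G` with respect to `ℋ` is fine and hyperbolic. (The vertex set of such a graph is a finite union
of coset spaces of `G`, so restricting it to the universe of `G` loses nothing.) -/
def IsRelHyperbolic {G : Type u} [Group G] [TopologicalSpace G] (ℋ : Set (Subgroup G)) : Prop :=
  IsProperPair ℋ ∧ ∃ (V : Type u) (_ : MulAction G V) (X : SimpleGraph V),
    IsCayleyAbelsGraph ℋ X ∧ IsFine X ∧ IsHyperbolicGraph X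

section Amalgam

/-- The two factors, as a family indexed by `Bool`. -/
abbrev Factor (A B : Type u) : Bool → Type u
  | false => A
  | true => B

instance (A B : Type u) [Group A] [Group B] : ∀ b, Group (Factor A B b)
  | false => inferInstanceAs (Group A)
  | true => inferInstanceAs (Group B)

variable {A B : Type u} {C : Type v} [Group A] [Group B] [Group C]

/-- The two edge maps, as a family indexed by `Bool`. -/
def edgeMap (iA : C →* A) (iB : C →* B) : ∀ b, C →* Factor A B b
  | false => iA
  | true => iB

/-- The amalgamated free product `A ∗_C B` along `iA : C → A` and `iB : C → B`. -/
def Amalgam (iA : C →* A) (iB : C →* B) : Type (max u v) :=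
  Monoid.PushoutI (edgeMap iA iB)

namespace Amalgam

instance (iA : C →* A) (iB : C →* B) : Group (Amalgam iA iB) :=
  inferInstanceAs (Group (Monoid.PushoutI (edgeMap iA iB)))

/-- The canonical map `A → A ∗_C B`. -/
def inl (iA : C →* A) (iB : C →* B) : A →* Amalgam iA iB :=
  Monoid.PushoutI.of (φ := edgeMap iA iB) false

/-- The canonical map `B → A ∗_C B`. -/
def inr (iA : C →* A) (iB : C →* B) : B →* Amalgam iA iB :=
  Monoid.PushoutI.of (φ := edgeMap iA iB) true

/-- The canonical map `C → A ∗_C B`. -/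
def base (iA : C →* A) (iB : C →* B) : C →* Amalgam iA iB :=
  Monoid.PushoutI.base (edgeMap iA iB)

theorem inl_apply (iA : C →* A) (iB : C →* B) (c : C) : inl iA iB (iA c) = base iA iB c :=
  Monoid.PushoutI.of_apply_eq_base (edgeMap iA iB) false c

theorem inr_apply (iA : C →* A) (iB : C →* B) (c : C) : inr iA iB (iB c) = base iA iB c :=
  Monoid.PushoutI.of_apply_eq_base (edgeMap iA iB) true c

theorem induction_on {iA : C →* A} {iB : C →* B} {p : Amalgam iA iB → Prop} (x : Amalgam iA iB)
    (hl : ∀ a, p (inl iA iB a)) (hr : ∀ b, p (inr iA iB b)) (hmul : ∀ x y, p x → p y → p (x * y)) :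
    p x := by
  refine Monoid.PushoutI.induction_on (motive := p) x ?_ ?_ hmul
  · rintro (_ | _) g
    · exact hl g
    · exact hr g
  · intro c
    have := hl (iA c)
    rw [inl_apply] at this
    exact this

theorem edgeMap_injective {iA : C →* A} {iB : C →* B} (hA : Function.Injective iA)
    (hB : Function.Injective iB) : ∀ b, Function.Injective (edgeMap iA iB b)
  | false => hA
  | true => hB

theorem inl_injective {iA : C →* A} {iB : C →* B} (hA : Function.Injective iA)
    (hB : Function.Injective iB) : Function.Injective (inl iA iB) :=
  Monoid.PushoutI.of_injective (edgeMap_injective hA hB) false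

theorem inr_injective {iA : C →* A} {iB : C →* B} (hA : Function.Injective iA)
    (hB : Function.Injective iB) : Function.Injective (inr iA iB) :=
  Monoid.PushoutI.of_injective (edgeMap_injective hA hB) true

theorem base_injective {iA : C →* A} {iB : C →* B} (hA : Function.Injective iA)
    (hB : Function.Injective iB) : Function.Injective (base iA iB) :=
  Monoid.PushoutI.base_injective (edgeMap_injective hA hB)

/-- The topology of `A ∗_C B`: a set is open if and only if its preimage under `c ↦ g * c` is open
in `C` for every `g`. When `C` is an open subgroup of `A` and of `B`, this is the unique group
topology for which `A` and `B` are embedded as open subgroups, see `Amalgam.topology_spec` and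
`Amalgam.topology_unique`. -/
instance topology [TopologicalSpace C] (iA : C →* A) (iB : C →* B) : TopologicalSpace (Amalgam iA iB) :=
  ⨆ g : Amalgam iA iB, TopologicalSpace.coinduced (fun c => g * base iA iB c) inferInstance

variable [TopologicalSpace C]

theorem isOpen_iff (iA : C →* A) (iB : C →* B) (U : Set (Amalgam iA iB)) :
    IsOpen U ↔ ∀ g, IsOpen ((fun c => g * base iA iB c) ⁻¹' U) := by
  refine isOpen_iSup_iff.trans ?_
  exact forall_congr' fun g => isOpen_coinduced

theorem continuous_mul_left' (iA : C →* A) (iB : C →* B) (x : Amalgam iA iB) :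
    Continuous (fun y => x * y) := by
  refine ⟨fun U hU => ?_⟩
  rw [isOpen_iff] at hU ⊢
  intro g
  have h := hU (x * g)
  simpa only [Set.preimage_preimage, mul_assoc] using h

theorem isOpenEmbedding_base [IsTopologicalGroup C] {iA : C →* A} {iB : C →* B}
    (hA : Function.Injective iA) (hB : Function.Injective iB) :
    Topology.IsOpenEmbedding (base iA iB) := by
  have hinj := base_injective hA hB
  refine .of_continuous_injective_isOpenMap ⟨fun U hU => ?_⟩ hinj ?_
  · simpa using (isOpen_iff iA iB U).1 hU 1
  · intro W hW
    rw [isOpen_iff]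
    intro g
    by_cases hg : ∃ c₀, base iA iB c₀ = g
    · obtain ⟨c₀, rfl⟩ := hg
      have : (fun c => base iA iB c₀ * base iA iB c) ⁻¹' (base iA iB '' W) =
          (fun c => c₀ * c) ⁻¹' W := by
        ext c
        simp only [Set.mem_preimage, ← map_mul, hinj.mem_set_image]
      rw [this]
      exact hW.preimage (continuous_const_mul c₀)
    · have : (fun c => g * base iA iB c) ⁻¹' (base iA iB '' W) = ∅ := by
        ext c
        simp only [Set.mem_preimage, Set.mem_image, Set.mem_empty_iff_false, iff_false]
        rintro ⟨d, -, hd⟩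
        exact hg ⟨d * c⁻¹, by rw [map_mul, hd, map_inv]; group⟩
      rw [this]
      exact isOpen_empty

variable [TopologicalSpace A] [TopologicalSpace B]
  [IsTopologicalGroup A] [IsTopologicalGroup B] [IsTopologicalGroup C]

theorem topology_spec {iA : C →* A} {iB : C →* B}
    (hA : Topology.IsOpenEmbedding iA) (hB : Topology.IsOpenEmbedding iB) :
    IsTopologicalGroup (Amalgam iA iB) ∧
      Topology.IsOpenEmbedding (inl iA iB) ∧ Topology.IsOpenEmbedding (inr iA iB) := by
  have hbase := isOpenEmbedding_base (iA := iA) (iB := iB) hA.injective hB.injective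
  have h1 : nhds (1 : Amalgam iA iB) = Filter.map (base iA iB) (nhds 1) := by
    rw [hbase.map_nhds_eq, map_one]
  have hl : Filter.map (inl iA iB) (nhds 1) = nhds 1 := by
    have := hA.map_nhds_eq 1
    rw [map_one] at this
    rw [← this, Filter.map_map, h1]
    congr 1
    exact funext (inl_apply iA iB)
  have hr : Filter.map (inr iA iB) (nhds 1) = nhds 1 := by
    have := hB.map_nhds_eq 1
    rw [map_one] at this
    rw [← this, Filter.map_map, h1]
    congr 1
    exact funext (inr_apply iA iB)
  have hconj : ∀ x : Amalgam iA iB, Filter.Tendsto (fun y => x * y * x⁻¹) (nhds 1) (nhds 1) := by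
    intro x
    have key : ∀ {D : Type u} [Group D] [TopologicalSpace D] [IsTopologicalGroup D]
        (f : D →* Amalgam iA iB), Filter.map f (nhds 1) = nhds 1 → ∀ d : D,
        Filter.Tendsto (fun y => f d * y * (f d)⁻¹) (nhds 1) (nhds 1) := by
      intro D _ _ _ f hf d
      rw [← hf, Filter.tendsto_map'_iff]
      have hc : Filter.Tendsto (fun y : D => d * y * d⁻¹) (nhds 1) (nhds 1) := by
        have : Continuous (fun y : D => d * y * d⁻¹) := by fun_prop
        simpa using this.tendsto 1
      have := (Filter.tendsto_map (f := f)).comp hc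
      refine this.congr fun y => ?_
      simp
    refine induction_on (p := fun x => Filter.Tendsto (fun y => x * y * x⁻¹) (nhds 1) (nhds 1)) x
      (key _ hl) (key _ hr) ?_
    · intro x y hx hy
      refine (hx.comp hy).congr fun z => ?_
      simp only [Function.comp, mul_inv_rev, mul_assoc]
  have hG : IsTopologicalGroup (Amalgam iA iB) := by
    refine IsTopologicalGroup.of_nhds_one ?_ ?_ ?_ hconj
    · rw [h1, Filter.prod_map_map_eq, Filter.tendsto_map'_iff]
      have hc : Filter.Tendsto (fun p : C × C => p.1 * p.2) (nhds 1 ×ˢ nhds 1) (nhds 1) := by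
        have := (continuous_mul (M := C)).tendsto (1, 1)
        rwa [nhds_prod_eq, mul_one] at this
      refine ((Filter.tendsto_map (f := base iA iB)).comp hc).congr fun p => ?_
      simp
    · rw [h1, Filter.tendsto_map'_iff]
      have hc : Filter.Tendsto (fun c : C => c⁻¹) (nhds 1) (nhds 1) := by
        simpa using (continuous_inv (G := C)).tendsto 1
      refine ((Filter.tendsto_map (f := base iA iB)).comp hc).congr fun p => ?_
      simp
    · intro x
      let e : Amalgam iA iB ≃ₜ Amalgam iA iB :=
        { toEquiv := Equiv.mulLeft x
          continuous_toFun := continuous_mul_left' iA iB x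
          continuous_invFun := continuous_mul_left' iA iB x⁻¹ }
      have := e.map_nhds_eq 1
      rw [show e 1 = x from mul_one x] at this
      exact this.symm
  have emb : ∀ {D : Type u} [Group D] [TopologicalSpace D] [IsTopologicalGroup D]
      (f : D →* Amalgam iA iB), Filter.map f (nhds 1) = nhds 1 → Function.Injective f →
      Topology.IsOpenEmbedding f := by
    intro D _ _ _ f hf hinj
    refine .of_continuous_injective_isOpenMap ?_ hinj ?_
    · refine continuous_of_continuousAt_one f ?_
      rw [ContinuousAt, map_one]
      exact hf.le
    · exact IsTopologicalGroup.isOpenMap_iff_nhds_one.2 hf.ge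
  exact ⟨hG, emb _ hl (inl_injective hA.injective hB.injective),
    emb _ hr (inr_injective hA.injective hB.injective)⟩

theorem topology_unique {iA : C →* A} {iB : C →* B}
    (hA : Topology.IsOpenEmbedding iA) (hB : Topology.IsOpenEmbedding iB)
    (t : TopologicalSpace (Amalgam iA iB)) (ht : @IsTopologicalGroup _ t _)
    (h : @Topology.IsOpenEmbedding _ _ _ t (inl iA iB)) :
    t = topology iA iB := by
  have aux : ∀ {D : Type u} {E : Type (max u v)} [Group D] [TopologicalSpace D] [Group E]
      [TopologicalSpace E] (f : D →* E), Topology.IsOpenEmbedding f →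
      nhds 1 = Filter.map f (nhds 1) := by
    intro D E _ _ _ _ f hf
    rw [hf.map_nhds_eq, map_one]
  exact IsTopologicalGroup.ext ht (topology_spec hA hB).1
    ((@aux _ _ _ _ _ t (inl iA iB) h).trans
      (@aux _ _ _ _ _ (topology iA iB) (inl iA iB) (topology_spec hA hB).2.1).symm)

end Amalgam

end Amalgam

end TDLC

/-!
The proof builds a Cayley-Abels graph of the amalgam out of Cayley-Abels graphs of the factors. It
is written for amalgams `Monoid.PushoutI φ` of finitely many groups, which treats the factors
symmetrically.

*Base vertices.* The compact open subgroup `C` need not fix a vertex of a given Cayley-Abels graph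
`X` of a factor. So a star is attached to `X` for each coset `a C`: its centre has stabilizer
`a C a⁻¹`, and its arms end at the finitely many points of `a C x₀`. If the arms are long compared to
the diameter of `C x₀`, then `X` stays isometrically embedded (`starGraph_dist_old`), so the new graph
is hyperbolic. It is fine (`starGraph_isFine`) because every edge of `X` lies on short paths between
points of `a C x₀` for finitely many cosets `a C` only: the stabilizer of the edge is compact and `C`
is open. Fineness is handled through Bowditch's criterion `isFine_iff_finite_avoids`, which replaces
embedded paths ending at `v` by walks that avoid `v`.

*The amalgam.* The vertices of the graph of `G` are the pairs `[g, x]` in `G ×_H V` for the factors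
`H` with graphs on `V`; translates of the graphs of the factors are joined by the edges
`[g, p] - [g, q]` between base vertices. Normal forms enter only through the map that sends `g ∈ G`
to the coset of its first syllable in a given factor. This map exists by the universal property of
the amalgam, as the solution of equations for its increments under right multiplication
(`exists_isProjection`). It makes each translate of the graph of a factor a block of the whole graph,
with a gate map `pr` that is constant on the components of the rest (`IsGate`).

A geodesic between points with different gates passes through both gates. Hence four points can be
moved to a common block, or split into two pairs, and the four-point inequality is inherited from the
blocks (`FourPoint.of_gates`); a walk that avoids a vertex is mapped to the block of that vertex, and
fineness is inherited too (`isFine_of_gates`). Finally, a non-compact open subgroup of a factor fixes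
no vertex outside the block of that factor, since it would also fix the gate, whose stabilizer is
compact (`HasBlocks.eq_of_map_le_stabilizer`). This gives the proper pair and the uniqueness of the
orbit of vertices with a given non-compact stabilizer.
-/

namespace TDLC

/-! ### Fineness through links -/

/-- There is a walk from `a` to `b` of length at most `n` that avoids the vertex `v`. -/
def Avoids {V : Type*} (X : SimpleGraph V) (v : V) (n : ℕ) (a b : V) : Prop :=
  ∃ p : X.Walk a b, v ∉ p.support ∧ p.length ≤ n

namespace Avoids

variable {V : Type*} {X : SimpleGraph V} {v a b c : V} {m n : ℕ}

theorem refl (h : a ≠ v) (n : ℕ) : Avoids X v n a a :=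
  ⟨.nil, by simpa using h.symm, Nat.zero_le _⟩

theorem left_ne (h : Avoids X v n a b) : a ≠ v := by
  rintro rfl
  obtain ⟨p, hp, -⟩ := h
  exact hp p.start_mem_support

theorem right_ne (h : Avoids X v n a b) : b ≠ v := by
  rintro rfl
  obtain ⟨p, hp, -⟩ := h
  exact hp p.end_mem_support

theorem mono (h : Avoids X v m a b) (hmn : m ≤ n) : Avoids X v n a b := by
  obtain ⟨p, hp, hl⟩ := h
  exact ⟨p, hp, hl.trans hmn⟩

theorem symm (h : Avoids X v n a b) : Avoids X v n b a := by
  obtain ⟨p, hp, hl⟩ := h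
  exact ⟨p.reverse, by simpa using hp, by simpa using hl⟩

theorem trans (h : Avoids X v m a b) (h' : Avoids X v n b c) : Avoids X v (m + n) a c := by
  obtain ⟨p, hp, hl⟩ := h
  obtain ⟨q, hq, hl'⟩ := h'
  refine ⟨p.append q, ?_, by rw [SimpleGraph.Walk.length_append]; omega⟩
  rw [SimpleGraph.Walk.mem_support_append_iff]
  tauto

theorem of_adj (h : X.Adj a b) (ha : a ≠ v) (hb : b ≠ v) : Avoids X v 1 a b :=
  ⟨.cons h .nil, by simp [ha.symm, hb.symm], by simp⟩

/-- Induction on the first step of a walk that avoids `v`. -/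
theorem head_induction {P : ℕ → V → Prop} (hrefl : b ≠ v → ∀ n, P n b)
    (hstep : ∀ n a a', X.Adj a a' → a ≠ v → Avoids X v n a' b → P n a' → P (n + 1) a)
    (h : Avoids X v n a b) : P n a := by
  obtain ⟨p, hp, hl⟩ := h
  induction p generalizing n with
  | nil => exact hrefl (by simpa [eq_comm] using hp) n
  | cons hadj q ih =>
    rw [SimpleGraph.Walk.support_cons, List.mem_cons, not_or] at hp
    rw [SimpleGraph.Walk.length_cons] at hl
    obtain ⟨k, rfl⟩ : ∃ k, n = k + 1 := ⟨n - 1, by omega⟩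
    exact hstep k _ _ hadj (Ne.symm hp.1) ⟨q, hp.2, by omega⟩ (ih hrefl hstep hp.2 (by omega))

end Avoids

/-- Bowditch's description of fineness: only finitely many neighbours of a vertex `v` can be
reached from a given vertex by walks of bounded length that avoid `v`. Unlike embedded paths, such
walks may be concatenated and mapped. -/
theorem isFine_iff_finite_avoids {V : Type v} (X : SimpleGraph V) :
    IsFine X ↔ ∀ (v a : V) (n : ℕ), {w | X.Adj v w ∧ Avoids X v n a w}.Finite := by
  classical
  constructor
  · intro h v a n
    have hfin : (⋃ m ∈ Set.Iic (n + 1), (fun p : X.Walk a v => p.penultimate) ''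
        {p | p.IsPath ∧ p.length = m}).Finite :=
      (Set.finite_Iic _).biUnion fun m _ => (h a v m).image _
    refine hfin.subset ?_
    rintro w ⟨hw, p, hp, hl⟩
    have hb : v ∉ p.bypass.support := fun hv => hp (p.support_bypass_subset_support hv)
    have hlen := p.length_bypass_le_length
    refine Set.mem_biUnion (x := p.bypass.length + 1) ?_ ⟨p.bypass.concat hw.symm, ⟨?_, ?_⟩, ?_⟩
    · exact Set.mem_Iic.2 (by omega)
    · exact p.bypass_isPath.concat hb hw.symm
    · simp
    · simp
  · intro h x y n
    induction n generalizing x with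
    | zero =>
      refine Set.Subsingleton.finite ?_
      rintro p ⟨-, hp⟩ q ⟨-, hq⟩
      have := SimpleGraph.Walk.eq_of_length_eq_zero hp
      subst this
      rw [SimpleGraph.Walk.length_eq_zero_iff] at hp hq
      rw [hp.eq_nil, hq.eq_nil]
    | succ n ih =>
      have hfin := h x y n
      have hfin' : (⋃ z ∈ {w | X.Adj x w ∧ Avoids X x n y w},
          ⋃ hz : X.Adj x z, (fun p : X.Walk z y => SimpleGraph.Walk.cons hz p) ''
            {p | p.IsPath ∧ p.length = n}).Finite :=
        hfin.biUnion fun z _ => Set.finite_iUnion fun hz => (ih z).image _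
      refine hfin'.subset ?_
      rintro p ⟨hp, hl⟩
      cases p with
      | nil => simp at hl
      | cons hadj q =>
        rw [SimpleGraph.Walk.cons_isPath_iff] at hp
        rw [SimpleGraph.Walk.length_cons, Nat.add_right_cancel_iff] at hl
        refine Set.mem_biUnion (x := _) ⟨hadj, Avoids.symm ⟨q, hp.2, hl.le⟩⟩ ?_
        exact Set.mem_iUnion.2 ⟨hadj, q, ⟨hp.1, hl⟩, rfl⟩

/-! ### Gates -/

/-- The graph `Y` sits in `X` through `emb` as a block with gate map `pr`: every connected piece of
the rest of `X` is attached to `Y` at a single vertex, and `pr` sends the piece to that vertex.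
This is encoded edgewise: an edge along which `pr` changes is an edge of `Y`. -/
structure IsGate {V W : Type*} (X : SimpleGraph V) (Y : SimpleGraph W) (emb : W → V)
    (pr : V → W) : Prop where
  pr_emb : ∀ y, pr (emb y) = y
  adj_emb : ∀ y z, Y.Adj y z → X.Adj (emb y) (emb z)
  of_pr_ne : ∀ a b, X.Adj a b → pr a ≠ pr b →
    Y.Adj (pr a) (pr b) ∧ emb (pr a) = a ∧ emb (pr b) = b

namespace IsGate

variable {V W : Type*} {X : SimpleGraph V} {Y : SimpleGraph W} {emb : W → V} {pr : V → W}

theorem emb_pr_mem_support (h : IsGate X Y emb pr) {a b : V} (p : X.Walk a b) (hab : pr a ≠ pr b) :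
    emb (pr a) ∈ p.support := by
  induction p with
  | nil => exact absurd rfl hab
  | @cons a c b hadj q ih =>
    rw [SimpleGraph.Walk.support_cons, List.mem_cons]
    by_cases hac : pr a = pr c
    · exact Or.inr (hac ▸ ih (hac ▸ hab))
    · exact Or.inl (h.of_pr_ne _ _ hadj hac).2.1

theorem exists_walk (h : IsGate X Y emb pr) {a b : V} (p : X.Walk a b) :
    ∃ q : Y.Walk (pr a) (pr b), q.length ≤ p.length := by
  induction p with
  | nil => exact ⟨.nil, le_rfl⟩
  | @cons a c b hadj q ih =>
    obtain ⟨q', hq'⟩ := ih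
    by_cases hac : pr a = pr c
    · rw [hac]
      exact ⟨q', by rw [SimpleGraph.Walk.length_cons]; omega⟩
    · exact ⟨.cons (h.of_pr_ne _ _ hadj hac).1 q', by simpa using hq'⟩

theorem dist_emb (h : IsGate X Y emb pr) (hX : X.Connected) (hY : Y.Connected) (y z : W) :
    X.dist (emb y) (emb z) = Y.dist y z := by
  apply le_antisymm
  · obtain ⟨p, hp⟩ := hY.exists_walk_length_eq_dist y z
    let f : Y →g X := ⟨emb, fun {a b} => h.adj_emb a b⟩
    rw [← hp, ← SimpleGraph.Walk.length_map f p]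
    exact SimpleGraph.dist_le (p.map f)
  · obtain ⟨p, hp⟩ := hX.exists_walk_length_eq_dist (emb y) (emb z)
    obtain ⟨q, hq⟩ := h.exists_walk p
    rw [← hp]
    refine le_trans ?_ hq
    simpa only [h.pr_emb] using SimpleGraph.dist_le q

theorem dist_eq_left (h : IsGate X Y emb pr) (hX : X.Connected) {a b : V} (hab : pr a ≠ pr b) :
    X.dist a b = X.dist a (emb (pr a)) + X.dist (emb (pr a)) b := by
  classical
  refine le_antisymm hX.dist_triangle ?_
  obtain ⟨p, hp⟩ := hX.exists_walk_length_eq_dist a b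
  have hm := h.emb_pr_mem_support p hab
  rw [← hp, ← p.take_spec hm, SimpleGraph.Walk.length_append]
  exact Nat.add_le_add (SimpleGraph.dist_le _) (SimpleGraph.dist_le _)

/-- A geodesic between points with different gates passes through both gates. -/
theorem dist_eq (h : IsGate X Y emb pr) (hX : X.Connected) {a b : V} (hab : pr a ≠ pr b) :
    X.dist a b = X.dist a (emb (pr a)) + X.dist (emb (pr a)) (emb (pr b)) +
      X.dist (emb (pr b)) b := by
  rw [h.dist_eq_left hX hab, X.dist_comm (u := emb (pr a)) (v := b),
    h.dist_eq_left hX (a := b) (b := emb (pr a)) (by rw [h.pr_emb]; exact hab.symm),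
    X.dist_comm (u := emb (pr b)), X.dist_comm (u := emb (pr b)) (v := b)]
  omega

theorem avoids_pr (h : IsGate X Y emb pr) {v a b : V} {n : ℕ} (hv : emb (pr v) = v)
    (hab : Avoids X v n a b) (hb : pr b ≠ pr v) : Avoids Y (pr v) n (pr a) (pr b) := by
  refine Avoids.head_induction (P := fun n a => Avoids Y (pr v) n (pr a) (pr b))
    (fun _ n => .refl hb n) ?_ hab
  intro n a a' hadj ha _ ih
  by_cases haa : pr a = pr a'
  · exact haa ▸ ih.mono (Nat.le_succ n)
  · obtain ⟨hY, h1, -⟩ := h.of_pr_ne _ _ hadj haa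
    rw [add_comm]
    refine (Avoids.of_adj hY ?_ ih.left_ne).trans ih
    intro hav
    exact ha (h1.symm.trans ((congrArg emb hav).trans hv))

end IsGate

/-- A graph is fine if every vertex lies in a fine block and has only finitely many neighbours
outside that block whose gate is the vertex itself. -/
theorem isFine_of_gates {V : Type v} {W : V → Type*} {X : SimpleGraph V}
    (Y : ∀ v, SimpleGraph (W v)) (emb : ∀ v, W v → V) (pr : ∀ v, V → W v)
    (h : ∀ v, IsGate X (Y v) (emb v) (pr v)) (hY : ∀ v, IsFine (Y v))
    (hv : ∀ v, emb v (pr v v) = v) (hfin : ∀ v, {w | X.Adj v w ∧ pr v w = pr v v}.Finite) :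
    IsFine X := by
  rw [isFine_iff_finite_avoids]
  intro v a n
  have h1 := (isFine_iff_finite_avoids (Y v)).1 (hY v) (pr v v) (pr v a) n
  refine ((hfin v).union (h1.image (emb v))).subset ?_
  rintro w ⟨hw, haw⟩
  by_cases hvw : pr v w = pr v v
  · exact Or.inl ⟨hw, hvw⟩
  · obtain ⟨hadj, -, hw'⟩ := (h v).of_pr_ne _ _ hw (Ne.symm hvw)
    exact Or.inr ⟨pr v w, ⟨hadj, (h v).avoids_pr (hv v) haw hvw⟩, hw'⟩

/-! ### The four-point condition in a graph with gates -/

/-- The symmetric form of the four-point inequality: among the three sums of distances of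
complementary pairs, none exceeds the maximum of the other two by more than `δ`. -/
def FourPoint {V : Type*} (X : SimpleGraph V) (δ : ℕ) (x y z t : V) : Prop :=
  X.dist x y + X.dist z t ≤ max (X.dist x z + X.dist y t) (X.dist x t + X.dist y z) + δ ∧
  X.dist x z + X.dist y t ≤ max (X.dist x y + X.dist z t) (X.dist x t + X.dist y z) + δ ∧
  X.dist x t + X.dist y z ≤ max (X.dist x y + X.dist z t) (X.dist x z + X.dist y t) + δ

theorem fourPoint_of_forall {V : Type*} {X : SimpleGraph V} {δ : ℕ}
    (h : ∀ x y z t : V,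
      X.dist x y + X.dist z t ≤ max (X.dist x z + X.dist y t) (X.dist x t + X.dist y z) + δ)
    (x y z t : V) : FourPoint X δ x y z t := by
  refine ⟨h x y z t, ?_, ?_⟩
  · have := h x z y t
    rwa [X.dist_comm (u := z) (v := y)] at this
  · have := h x t y z
    rw [X.dist_comm (u := t) (v := y), X.dist_comm (u := t) (v := z)] at this
    omega

namespace FourPoint

variable {V : Type*} {X : SimpleGraph V} {δ : ℕ} {x y z t : V}

theorem swap (h : FourPoint X δ x y z t) : FourPoint X δ y x z t := by
  obtain ⟨h1, h2, h3⟩ := h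
  refine ⟨?_, ?_, ?_⟩ <;> simp only [X.dist_comm (u := y) (v := x)] <;> omega

theorem rotate (h : FourPoint X δ x y z t) : FourPoint X δ y z t x := by
  obtain ⟨h1, h2, h3⟩ := h
  refine ⟨?_, ?_, ?_⟩ <;>
    simp only [X.dist_comm (u := y) (v := x), X.dist_comm (u := z) (v := x),
      X.dist_comm (u := t) (v := x)] <;> omega

theorem mono {δ' : ℕ} (h : FourPoint X δ x y z t) (hδ : δ ≤ δ') : FourPoint X δ' x y z t := by
  obtain ⟨h1, h2, h3⟩ := h
  exact ⟨by omega, by omega, by omega⟩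

variable {W : Type*} {Y : SimpleGraph W} {emb : W → V} {pr : V → W}

/-- A gate separating two points from the other two makes the two largest sums equal. -/
theorem of_gate_pair (h : IsGate X Y emb pr) (hX : X.Connected) (hxy : pr x = pr y)
    (hz : pr z ≠ pr x) (ht : pr t ≠ pr x) : FourPoint X 0 x y z t := by
  have e1 := h.dist_eq_left hX hz.symm
  have e2 := h.dist_eq_left hX ht.symm
  have e3 := h.dist_eq_left hX (hxy ▸ hz.symm)
  have e4 := h.dist_eq_left hX (hxy ▸ ht.symm)
  rw [← hxy] at e3 e4
  have t1 := hX.dist_triangle (u := x) (v := emb (pr x)) (w := y)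
  have t2 := hX.dist_triangle (u := z) (v := emb (pr x)) (w := t)
  rw [X.dist_comm (u := emb (pr x)) (v := y)] at t1
  rw [X.dist_comm (u := z) (v := emb (pr x))] at t2
  refine ⟨?_, ?_, ?_⟩ <;> omega

/-- If the first three points have the same gate, the fourth can be moved to that gate. -/
theorem of_gate_triple (h : IsGate X Y emb pr) (hX : X.Connected) (hy : pr y = pr x)
    (hz : pr z = pr x) (ht : pr t ≠ pr x) (h4 : FourPoint X δ x y z (emb (pr x))) :
    FourPoint X δ x y z t := by
  have e1 := h.dist_eq_left hX ht.symm
  have e2 := h.dist_eq_left hX (hy ▸ ht.symm)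
  have e3 := h.dist_eq_left hX (hz ▸ ht.symm)
  rw [hy] at e2
  rw [hz] at e3
  obtain ⟨h1, h2, h3⟩ := h4
  refine ⟨?_, ?_, ?_⟩ <;> omega

/-- If the four gates are distinct, the four points can be moved to their gates. -/
theorem of_gate_distinct (h : IsGate X Y emb pr) (hX : X.Connected) (hY : Y.Connected)
    (hxy : pr x ≠ pr y) (hxz : pr x ≠ pr z) (hxt : pr x ≠ pr t) (hyz : pr y ≠ pr z)
    (hyt : pr y ≠ pr t) (hzt : pr z ≠ pr t) (h4 : FourPoint Y δ (pr x) (pr y) (pr z) (pr t)) :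
    FourPoint X δ x y z t := by
  have e1 := h.dist_eq hX hxy
  have e2 := h.dist_eq hX hxz
  have e3 := h.dist_eq hX hxt
  have e4 := h.dist_eq hX hyz
  have e5 := h.dist_eq hX hyt
  have e6 := h.dist_eq hX hzt
  have c1 := X.dist_comm (u := emb (pr y)) (v := y)
  have c2 := X.dist_comm (u := emb (pr z)) (v := z)
  rw [h.dist_emb hX hY] at e1 e2 e3 e4 e5 e6
  obtain ⟨h1, h2, h3⟩ := h4
  refine ⟨?_, ?_, ?_⟩ <;> omega

/-- Points separated by no gate are at distance at most one; as long as some gate separates two of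
the four points, it either settles the inequality or allows one point to be moved closer to the
others. -/
theorem of_gates {K : Type*} {W : K → Type*} {Y : ∀ k, SimpleGraph (W k)} {emb : ∀ k, W k → V}
    {pr : ∀ k, V → W k} (h : ∀ k, IsGate X (Y k) (emb k) (pr k)) (hX : X.Connected)
    (hY : ∀ k, (Y k).Connected) (h4 : ∀ k a b c d, FourPoint (Y k) δ a b c d)
    (hsep : ∀ a b, 2 ≤ X.dist a b → ∃ k, pr k a ≠ pr k b) (x y z t : V) :
    FourPoint X (max δ 2) x y z t := by
  induction hN : X.dist x y + X.dist x z + X.dist x t + X.dist y z + X.dist y t + X.dist z t using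
    Nat.strong_induction_on generalizing x y z t with
  | _ N ih =>
  subst hN
  have triple : ∀ k a b c d, pr k b = pr k a → pr k c = pr k a → pr k d ≠ pr k a →
      X.dist a b + X.dist a c + X.dist a d + X.dist b c + X.dist b d + X.dist c d =
        X.dist x y + X.dist x z + X.dist x t + X.dist y z + X.dist y t + X.dist z t →
      FourPoint X (max δ 2) a b c d := by
    intro k a b c d hb hc hd hs
    refine of_gate_triple (h k) hX hb hc hd (ih _ ?_ _ _ _ _ rfl)
    have e1 := (h k).dist_eq_left hX hd.symm
    have e2 := (h k).dist_eq_left hX (hb ▸ hd.symm)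
    have e3 := (h k).dist_eq_left hX (hc ▸ hd.symm)
    rw [hb] at e2
    rw [hc] at e3
    have hpos : 0 < X.dist (emb k (pr k a)) d := by
      refine hX.pos_dist_of_ne ?_
      rintro rfl
      exact hd ((h k).pr_emb _)
    omega
  have pair : ∀ k a b c d, pr k a = pr k b → pr k c ≠ pr k a → pr k d ≠ pr k a →
      FourPoint X (max δ 2) a b c d := fun k a b c d hab hc hd =>
    (of_gate_pair (h k) hX hab hc hd).mono (Nat.zero_le _)
  have cyx := X.dist_comm (u := y) (v := x)
  have czx := X.dist_comm (u := z) (v := x)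
  have ctx := X.dist_comm (u := t) (v := x)
  have czy := X.dist_comm (u := z) (v := y)
  have cty := X.dist_comm (u := t) (v := y)
  have ctz := X.dist_comm (u := t) (v := z)
  by_cases hk : ∃ k, ¬ (pr k x = pr k y ∧ pr k x = pr k z ∧ pr k x = pr k t)
  · obtain ⟨k, hk⟩ := hk
    by_cases hxy : pr k x = pr k y
    · by_cases hxz : pr k x = pr k z
      · exact triple k _ _ _ _ hxy.symm hxz.symm (fun e => hk ⟨hxy, hxz, e.symm⟩) rfl
      · by_cases hxt : pr k x = pr k t
        · exact (triple k t x y z hxt (hxt ▸ hxy.symm) (fun e => hxz (by rw [e, hxt]))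
            (by omega)).rotate
        · exact pair k _ _ _ _ hxy (Ne.symm hxz) (Ne.symm hxt)
    · by_cases hxz : pr k x = pr k z
      · by_cases hxt : pr k x = pr k t
        · exact (triple k z t x y (by rw [← hxt, hxz]) hxz (fun e => hxy (by rw [e, hxz]))
            (by omega)).rotate.rotate
        · exact (pair k z x y t hxz.symm (fun e => hxy (by rw [e, hxz]))
            (fun e => hxt (by rw [e, hxz]))).swap.rotate.swap.rotate.rotate.rotate
      · by_cases hxt : pr k x = pr k t
        · exact (pair k t x y z hxt.symm (fun e => hxy (by rw [e, hxt]))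
            (fun e => hxz (by rw [e, hxt]))).rotate
        · by_cases hyz : pr k y = pr k z
          · by_cases hyt : pr k y = pr k t
            · exact (triple k y z t x hyz.symm hyt.symm hxy (by omega)).rotate.rotate.rotate
            · exact (pair k y z t x hyz (Ne.symm hyt) hxy).rotate.rotate.rotate
          · by_cases hyt : pr k y = pr k t
            · exact (pair k t y x z hyt.symm hxt (fun e => hyz (by rw [e, hyt]))).rotate.swap
            · by_cases hzt : pr k z = pr k t
              · exact (pair k z t x y hzt hxz hyz).rotate.rotate
              · exact of_gate_distinct (h k) hX (hY k) hxy hxz hxt hyz hyt hzt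
                  ((h4 k _ _ _ _).mono (le_max_left _ _))
  · have hle : ∀ a b, (∀ k, pr k a = pr k b) → X.dist a b ≤ 1 := by
      intro a b hab
      by_contra hlt
      obtain ⟨k, hk⟩ := hsep a b (by omega)
      exact hk (hab k)
    push Not at hk
    have d1 := hle x y fun k => (hk k).1
    have d2 := hle x z fun k => (hk k).2.1
    have d3 := hle x t fun k => (hk k).2.2
    have d4 := hle y z fun k => (hk k).1 ▸ (hk k).2.1
    have d5 := hle y t fun k => (hk k).1 ▸ (hk k).2.2
    have d6 := hle z t fun k => (hk k).2.1 ▸ (hk k).2.2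
    refine ⟨?_, ?_, ?_⟩ <;> omega

end FourPoint

/-! ### Fineness and jumps -/

theorem Avoids.of_le {V : Type*} {X X' : SimpleGraph V} (hXX' : X ≤ X') {v a b : V} {n : ℕ}
    (h : Avoids X v n a b) : Avoids X' v n a b := by
  obtain ⟨p, hp, hl⟩ := h
  exact ⟨p.mapLe hXX', by simpa using hp, by simpa using hl⟩

/-- A walk that starts away from `v` either avoids `v` or has an initial part that avoids `v` and
is followed by an edge to `v`. -/
theorem avoids_or_exists_edge {V : Type*} {X : SimpleGraph V} {v a b : V} (p : X.Walk a b)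
    (ha : a ≠ v) : Avoids X v p.length a b ∨
      ∃ e, X.Adj v e ∧ s(v, e) ∈ p.edges ∧ Avoids X v p.length a e := by
  induction p with
  | nil => exact Or.inl (.refl ha _)
  | @cons a c b hadj q ih =>
    rw [SimpleGraph.Walk.length_cons, SimpleGraph.Walk.edges_cons]
    by_cases hc : c = v
    · subst hc
      exact Or.inr ⟨a, hadj.symm, by simp [Sym2.eq_swap], .refl ha _⟩
    · rw [add_comm]
      rcases ih hc with h | ⟨e, he, hm, h⟩
      · exact Or.inl ((Avoids.of_adj hadj ha hc).trans h)
      · exact Or.inr ⟨e, he, List.mem_cons_of_mem _ hm, (Avoids.of_adj hadj ha hc).trans h⟩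

/-- The graph obtained from `X` by adding all edges between distinct points of each `S j`. -/
def jumpGraph {V J : Type*} (X : SimpleGraph V) (S : J → Set V) : SimpleGraph V :=
  X ⊔ SimpleGraph.fromRel fun a b => ∃ j, a ∈ S j ∧ b ∈ S j

theorem jumpGraph_adj {V J : Type*} {X : SimpleGraph V} {S : J → Set V} {a b : V} :
    (jumpGraph X S).Adj a b ↔ X.Adj a b ∨ a ≠ b ∧ ∃ j, a ∈ S j ∧ b ∈ S j := by
  rw [jumpGraph, SimpleGraph.sup_adj, SimpleGraph.fromRel_adj]
  have : (∃ j, b ∈ S j ∧ a ∈ S j) ↔ ∃ j, a ∈ S j ∧ b ∈ S j := by simp only [and_comm]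
  rw [this, or_self]

/-- The sets `S j` are spanned by walks in `X` of length at most `D`, with the walks for `j` running
in the edge set `E j`, in such a way that each edge of `X` is used for finitely many `j` only. -/
structure IsSpanned {V J : Type*} (X : SimpleGraph V) (S : J → Set V) (E : J → Set (Sym2 V))
    (D : ℕ) : Prop where
  exists_walk : ∀ j, ∀ a ∈ S j, ∀ b ∈ S j, ∃ p : X.Walk a b, p.length ≤ D ∧ ∀ e ∈ p.edges, e ∈ E j
  finite : ∀ j, (S j).Finite
  nonempty : ∀ j, (S j).Nonempty
  finite_index : ∀ e ∈ X.edgeSet, {j | e ∈ E j}.Finite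

namespace IsSpanned

variable {V : Type v} {J : Type*} {X : SimpleGraph V} {S : J → Set V} {E : J → Set (Sym2 V)} {D : ℕ}

theorem avoids_or (h : IsSpanned X S E D) {v a b : V} {j : J} (ha : a ∈ S j) (hb : b ∈ S j)
    (hav : a ≠ v) : Avoids X v D a b ∨
      ∃ e, X.Adj v e ∧ s(v, e) ∈ E j ∧ Avoids X v D a e := by
  obtain ⟨p, hp, hE⟩ := h.exists_walk j a ha b hb
  rcases avoids_or_exists_edge p hav with h | ⟨e, he, hm, h⟩
  · exact Or.inl (h.mono hp)
  · exact Or.inr ⟨e, he, hE _ hm, h.mono hp⟩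

/-- A walk with jumps that avoids `v` either can be replaced by a walk in `X` that avoids `v`, or it
has a first jump whose spanning walk goes through `v`. -/
theorem avoids_jump (h : IsSpanned X S E D) {v a b : V} {n : ℕ}
    (hab : Avoids (jumpGraph X S) v n a b) :
    Avoids X v ((D + 1) * n) a b ∨ ∃ e j c k, X.Adj v e ∧ s(v, e) ∈ E j ∧
      Avoids X v ((D + 1) * n) a e ∧ c ∈ S j ∧ k < n ∧ Avoids (jumpGraph X S) v k c b := by
  refine Avoids.head_induction (P := fun n a => Avoids X v ((D + 1) * n) a b ∨ ∃ e j c k,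
      X.Adj v e ∧ s(v, e) ∈ E j ∧ Avoids X v ((D + 1) * n) a e ∧ c ∈ S j ∧ k < n ∧
      Avoids (jumpGraph X S) v k c b) (fun hb n => Or.inl (.refl hb _)) ?_ hab
  intro n a a' hadj ha ha' ih
  have key : Avoids X v (D + 1) a a' ∨ ∃ e j, X.Adj v e ∧ s(v, e) ∈ E j ∧
      Avoids X v (D + 1) a e ∧ a' ∈ S j := by
    rcases jumpGraph_adj.1 hadj with hX | ⟨-, j, hj, hj'⟩
    · exact Or.inl ((Avoids.of_adj hX ha ha'.left_ne).mono (by omega))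
    · rcases h.avoids_or hj hj' ha with h1 | ⟨e, he, hE, h1⟩
      · exact Or.inl (h1.mono (by omega))
      · exact Or.inr ⟨e, j, he, hE, h1.mono (by omega), hj'⟩
  have hn : (D + 1) * (n + 1) = (D + 1) + (D + 1) * n := by ring
  rw [hn]
  rcases key with h1 | ⟨e, j, he, hE, h1, hj⟩
  · rcases ih with h2 | ⟨e, j, c, k, he, hE, h2, hc, hk, h3⟩
    · exact Or.inl (h1.trans h2)
    · exact Or.inr ⟨e, j, c, k, he, hE, h1.trans h2, hc, by omega, h3⟩
  · exact Or.inr ⟨e, j, a', n, he, hE, h1.mono (by omega), hj, by omega, ha'⟩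

theorem finite_avoids_jump (h : IsSpanned X S E D) (hX : IsFine X) (v a : V) (n : ℕ) :
    {w | X.Adj v w ∧ Avoids (jumpGraph X S) v n a w}.Finite := by
  rw [isFine_iff_finite_avoids] at hX
  induction n using Nat.strong_induction_on generalizing a with
  | _ n ih =>
  have hfin : (⋃ e ∈ {w | X.Adj v w ∧ Avoids X v ((D + 1) * n) a w},
      ⋃ j ∈ {j | X.Adj v e ∧ s(v, e) ∈ E j}, ⋃ c ∈ S j, ⋃ k ∈ Set.Iio n,
        {w | k < n ∧ X.Adj v w ∧ Avoids (jumpGraph X S) v k c w}).Finite := by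
    refine (hX v a _).biUnion fun e he => Set.Finite.biUnion ?_ fun j _ =>
      (h.finite j).biUnion fun c _ => (Set.finite_Iio n).biUnion fun k hk => ?_
    · exact (h.finite_index s(v, e) he.1).subset fun j hj => hj.2
    · exact (ih k hk c).subset fun w hw => hw.2
  refine ((hX v a ((D + 1) * n)).union hfin).subset ?_
  rintro w ⟨hw, haw⟩
  rcases h.avoids_jump haw with h1 | ⟨e, j, c, k, he, hE, h1, hc, hk, h2⟩
  · exact Or.inl ⟨hw, h1⟩
  · refine Or.inr ?_
    simp only [Set.mem_iUnion, Set.mem_ofPred_eq, Set.mem_Iio]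
    exact ⟨e, ⟨he, h1⟩, j, ⟨he, hE⟩, c, hc, k, hk, hk, hw, h2⟩

/-- Only finitely many `j` with `v ∈ S j` have another point of `S j` within bounded distance of
`a`, for walks with jumps that avoid `v`. -/
theorem finite_index_avoids_jump (h : IsSpanned X S E D) (hX : IsFine X) (v a : V) (n : ℕ) :
    {j | v ∈ S j ∧ ∃ c ∈ S j, Avoids (jumpGraph X S) v n a c}.Finite := by
  have hfin : (⋃ e ∈ {w | X.Adj v w ∧ Avoids (jumpGraph X S) v (n + D) a w},
      {j | X.Adj v e ∧ s(v, e) ∈ E j}).Finite :=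
    (h.finite_avoids_jump hX v a (n + D)).biUnion fun e he =>
      (h.finite_index s(v, e) he.1).subset fun j hj => hj.2
  refine hfin.subset ?_
  rintro j ⟨hv, c, hc, hac⟩
  rcases h.avoids_or hc hv hac.right_ne with h1 | ⟨e, he, hE, h1⟩
  · exact absurd rfl h1.right_ne
  · exact Set.mem_biUnion (x := e) ⟨he, hac.trans (h1.of_le le_sup_left)⟩ ⟨he, hE⟩

end IsSpanned

/-! ### Attaching stars -/

/-- The vertices of the graph obtained from a graph on `V` by attaching, for each `j`, a star with
centre `j` whose arms end at the points of `S j`; each arm has `m + 1` interior vertices, and the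
`k`-th of them is at distance `k + 1` from the end of the arm. -/
inductive StarVertex {V J : Type*} (S : J → Set V) (m : ℕ) : Type _
  | old (x : V) : StarVertex S m
  | arm (j : J) (s : V) (hs : s ∈ S j) (k : Fin (m + 1)) : StarVertex S m
  | center (j : J) : StarVertex S m

/-- The edges of a graph with stars attached, in one orientation. -/
inductive StarRel {V J : Type*} (X : SimpleGraph V) (S : J → Set V) (m : ℕ) :
    StarVertex S m → StarVertex S m → Prop
  | old (x y : V) (h : X.Adj x y) : StarRel X S m (.old x) (.old y)
  | base (j : J) (s : V) (hs : s ∈ S j) : StarRel X S m (.old s) (.arm j s hs 0)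
  | step (j : J) (s : V) (hs : s ∈ S j) (k : Fin m) :
      StarRel X S m (.arm j s hs k.castSucc) (.arm j s hs k.succ)
  | top (j : J) (s : V) (hs : s ∈ S j) : StarRel X S m (.arm j s hs (Fin.last m)) (.center j)

theorem StarRel.ne {V J : Type*} {X : SimpleGraph V} {S : J → Set V} {m : ℕ}
    {a b : StarVertex S m} (h : StarRel X S m a b) : a ≠ b := by
  cases h with
  | old x y h => simpa using h.ne
  | base => simp
  | step j s hs k => simp [Fin.ext_iff]
  | top => simp

/-- The graph obtained from `X` by attaching a star to each `S j`. -/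
def starGraph {V J : Type*} (X : SimpleGraph V) (S : J → Set V) (m : ℕ) :
    SimpleGraph (StarVertex S m) :=
  SimpleGraph.fromRel (StarRel X S m)

section starGraph

variable {V : Type v} {J : Type*} {X : SimpleGraph V} {S : J → Set V} {m : ℕ}

theorem starGraph_adj {a b : StarVertex S m} :
    (starGraph X S m).Adj a b ↔ StarRel X S m a b ∨ StarRel X S m b a := by
  rw [starGraph, SimpleGraph.fromRel_adj, and_iff_right_iff_imp]
  rintro (h | h)
  exacts [h.ne, h.ne.symm]

theorem StarRel.adj {a b : StarVertex S m} (h : StarRel X S m a b) : (starGraph X S m).Adj a b :=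
  starGraph_adj.2 (Or.inl h)

theorem exists_walk_arm (j : J) (s : V) (hs : s ∈ S j) (k : Fin (m + 1)) :
    ∃ p : (starGraph X S m).Walk (.arm j s hs k) (.old s), p.length = k + 1 := by
  induction k using Fin.induction with
  | zero => exact ⟨.cons (StarRel.base j s hs).adj.symm .nil, by simp⟩
  | succ k ih =>
    obtain ⟨p, hp⟩ := ih
    exact ⟨.cons (StarRel.step j s hs k).adj.symm p, by simp [hp]⟩

theorem exists_walk_old (hS : ∀ j, (S j).Nonempty) (a : StarVertex S m) :
    ∃ (x : V) (p : (starGraph X S m).Walk a (.old x)), p.length ≤ m + 2 := by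
  cases a with
  | old x => exact ⟨x, .nil, by simp⟩
  | arm j s hs k =>
    obtain ⟨p, hp⟩ := exists_walk_arm (X := X) j s hs k
    exact ⟨s, p, by have := k.isLt; omega⟩
  | center j =>
    obtain ⟨s, hs⟩ := hS j
    obtain ⟨p, hp⟩ := exists_walk_arm (X := X) j s hs (Fin.last m)
    exact ⟨s, .cons (StarRel.top j s hs).adj.symm p, by simp [hp]⟩

theorem exists_walk_old_old {x y : V} (p : X.Walk x y) :
    ∃ q : (starGraph X S m).Walk (.old x) (.old y), q.length = p.length := by
  induction p with
  | nil => exact ⟨.nil, rfl⟩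
  | cons h p ih =>
    obtain ⟨q, hq⟩ := ih
    exact ⟨.cons (StarRel.old _ _ h).adj q, by simp [hq]⟩

theorem starGraph_connected (hX : X.Connected) (hS : ∀ j, (S j).Nonempty) :
    (starGraph X S m).Connected := by
  have : Nonempty V := hX.nonempty
  have : Nonempty (StarVertex S m) := ⟨.old (Classical.arbitrary V)⟩
  refine ⟨fun a b => ?_⟩
  obtain ⟨x, p, -⟩ := exists_walk_old (X := X) hS a
  obtain ⟨y, q, -⟩ := exists_walk_old (X := X) hS b
  obtain ⟨r⟩ := hX.preconnected x y
  obtain ⟨r', -⟩ := exists_walk_old_old (S := S) (m := m) r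
  exact ⟨p.append (r'.append q.reverse)⟩

/-- A function which is `1`-Lipschitz along the edges of `X` extends over stars whose arms are at
least half as long as the function oscillates on `S j`. -/
theorem exists_potential (f : V → ℤ) (hf : ∀ x y, X.Adj x y → f x ≤ f y + 1)
    (hfin : ∀ j, (S j).Finite) (hS : ∀ j, (S j).Nonempty)
    (hfS : ∀ j, ∀ s ∈ S j, ∀ t ∈ S j, f s ≤ f t + 2 * (m + 2)) :
    ∃ F : StarVertex S m → ℤ, (∀ x, F (.old x) = f x) ∧
      ∀ a b, (starGraph X S m).Adj a b → F b ≤ F a + 1 := by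
  have hc : ∀ j, ∃ c : ℤ, ∀ s ∈ S j, f s ≤ c + (m + 2) ∧ c ≤ f s + (m + 2) := by
    intro j
    obtain ⟨t, ht, hmax⟩ := Set.exists_max_image (S j) f (hfin j) (hS j)
    refine ⟨f t - (m + 2), fun s hs => ⟨by have := hmax s hs; omega, ?_⟩⟩
    have := hfS j t ht s hs
    omega
  choose c hc using hc
  let F : StarVertex S m → ℤ
    | .old x => f x
    | .arm j s _ k => max (f s - (k + 1)) (c j - (m + 1 - k))
    | .center j => c j
  have hF : ∀ a b, StarRel X S m a b → F a ≤ F b + 1 ∧ F b ≤ F a + 1 := by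
    intro a b hab
    cases hab with
    | old x y h => exact ⟨hf x y h, hf y x h.symm⟩
    | base j s hs =>
      have := hc j s hs
      simp only [F, Fin.val_zero]
      omega
    | step j s hs k =>
      simp only [F, Fin.val_castSucc, Fin.val_succ]
      omega
    | top j s hs =>
      have := hc j s hs
      simp only [F, Fin.val_last]
      omega
  refine ⟨F, fun x => rfl, fun a b hab => ?_⟩
  rcases starGraph_adj.1 hab with h | h
  exacts [(hF _ _ h).2, (hF _ _ h).1]

/-- Attaching stars with sufficiently long arms does not change the distance in `X`. -/
theorem starGraph_dist_old (hX : X.Connected) (hfin : ∀ j, (S j).Finite)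
    (hS : ∀ j, (S j).Nonempty) (hdist : ∀ j, ∀ s ∈ S j, ∀ t ∈ S j, X.dist s t ≤ 2 * (m + 2))
    (x y : V) : (starGraph X S m).dist (.old x) (.old y) = X.dist x y := by
  apply le_antisymm
  · obtain ⟨p, hp⟩ := hX.exists_walk_length_eq_dist x y
    obtain ⟨q, hq⟩ := exists_walk_old_old (S := S) (m := m) p
    rw [← hp, ← hq]
    exact SimpleGraph.dist_le q
  · obtain ⟨F, hF, hF'⟩ := exists_potential (X := X) (S := S) (m := m)
      (fun z => (X.dist x z : ℤ)) (fun z z' h => by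
        have h1 := hX.dist_triangle (u := x) (v := z') (w := z)
        rw [SimpleGraph.dist_eq_one_iff_adj.2 h.symm] at h1
        exact_mod_cast h1) hfin hS (fun j s hs t ht => by
        have h1 := hX.dist_triangle (u := x) (v := t) (w := s)
        have h2 := hdist j t ht s hs
        omega)
    have hwalk : ∀ a b (p : (starGraph X S m).Walk a b), F b ≤ F a + p.length := by
      intro a b p
      induction p with
      | nil => simp
      | cons h p ih =>
        have := hF' _ _ h
        rw [SimpleGraph.Walk.length_cons]
        push_cast
        omega
    obtain ⟨p, hp⟩ := (starGraph_connected (m := m) hX hS).exists_walk_length_eq_dist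
      (.old x) (.old y)
    have := hwalk _ _ p
    rw [hF, hF, SimpleGraph.dist_self, hp] at this
    exact_mod_cast (by simpa using this)

theorem starGraph_isHyperbolic (hX : X.Connected) (hhyp : IsHyperbolicGraph X)
    (hfin : ∀ j, (S j).Finite) (hS : ∀ j, (S j).Nonempty)
    (hdist : ∀ j, ∀ s ∈ S j, ∀ t ∈ S j, X.dist s t ≤ 2 * (m + 2)) :
    IsHyperbolicGraph (starGraph X S m) := by
  obtain ⟨δ, hδ⟩ := hhyp
  refine ⟨δ + 8 * (m + 2), fun a b c d => ?_⟩
  have hconn := starGraph_connected (m := m) hX hS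
  have happrox : ∀ a : StarVertex S m, ∃ x, (starGraph X S m).dist a (.old x) ≤ m + 2 := by
    intro a
    obtain ⟨x, p, hp⟩ := exists_walk_old (X := X) hS a
    exact ⟨x, (SimpleGraph.dist_le p).trans hp⟩
  have hcomp : ∀ (a b : StarVertex S m) (x y : V), (starGraph X S m).dist a (.old x) ≤ m + 2 →
      (starGraph X S m).dist b (.old y) ≤ m + 2 →
      (starGraph X S m).dist a b ≤ X.dist x y + 2 * (m + 2) ∧
      X.dist x y ≤ (starGraph X S m).dist a b + 2 * (m + 2) := by
    intro a b x y hx hy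
    rw [← starGraph_dist_old (m := m) hX hfin hS hdist]
    have h1 := hconn.dist_triangle (u := a) (v := .old x) (w := b)
    have h2 := hconn.dist_triangle (u := .old x) (v := .old y) (w := b)
    have h3 := hconn.dist_triangle (u := .old x) (v := a) (w := .old y)
    have h4 := hconn.dist_triangle (u := a) (v := b) (w := .old y)
    have h5 := (starGraph X S m).dist_comm (u := .old y) (v := b)
    have h6 := (starGraph X S m).dist_comm (u := .old x) (v := a)
    omega
  obtain ⟨x, hx⟩ := happrox a
  obtain ⟨y, hy⟩ := happrox b
  obtain ⟨z, hz⟩ := happrox c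
  obtain ⟨t, ht⟩ := happrox d
  have h0 := hδ x y z t
  have h1 := hcomp a b x y hx hy
  have h2 := hcomp c d z t hz ht
  have h3 := hcomp a c x z hx hz
  have h4 := hcomp b d y t hy ht
  have h5 := hcomp a d x t hx ht
  have h6 := hcomp b c y z hy hz
  omega

/-- The index of the star to which a new vertex belongs. -/
def StarVertex.star : StarVertex S m → Option J
  | .old _ => none
  | .arm j _ _ _ => some j
  | .center j => some j

theorem finite_neighbors_of_star (hfin : ∀ j, (S j).Finite) {a : StarVertex S m} {j : J}
    (ha : a.star = some j) : {b | (starGraph X S m).Adj a b}.Finite := by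
  have hF : (insert (StarVertex.center j) (StarVertex.old '' S j ∪
      ⋃ s ∈ S j, ⋃ hs : s ∈ S j, Set.range (StarVertex.arm j s hs : Fin (m + 1) → _))).Finite :=
    (((hfin j).image _).union ((hfin j).biUnion fun s _ =>
      Set.finite_iUnion fun hs => Set.finite_range _)).insert _
  refine hF.subset fun b hb => ?_
  simp only [Set.mem_insert_iff, Set.mem_union, Set.mem_image, Set.mem_iUnion, Set.mem_range]
  rcases starGraph_adj.1 hb with h | h <;> cases h <;> simp [StarVertex.star] at ha ⊢ <;>
    subst ha <;> first | assumption | simp_all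

theorem starGraph_isFine {E : J → Set (Sym2 V)} {D : ℕ} (h : IsSpanned X S E D) (hX : IsFine X) :
    IsFine (starGraph X S m) := by
  classical
  rw [isFine_iff_finite_avoids]
  intro v' a n
  rcases hv' : v'.star with _ | j
  swap
  · exact (finite_neighbors_of_star h.finite hv').subset fun w hw => hw.1
  obtain ⟨v, rfl⟩ : ∃ v, v' = .old v := by
    cases v' with
    | old v => exact ⟨v, rfl⟩
    | arm => simp [StarVertex.star] at hv'
    | center => simp [StarVertex.star] at hv'
  have hc : ∀ j, ∃ c ∈ S j, c = v → ∀ s ∈ S j, s = v := by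
    intro j
    by_cases hj : ∃ c ∈ S j, c ≠ v
    · obtain ⟨c, hc, hcv⟩ := hj
      exact ⟨c, hc, fun e => absurd e hcv⟩
    · push Not at hj
      obtain ⟨c, hc⟩ := h.nonempty j
      exact ⟨c, hc, fun _ => hj⟩
  choose c hcS hcv using hc
  -- `ρ` collapses the stars onto `V`, moving to `c j` whatever would collapse to `v`. It maps edges
  -- that avoid `v` to edges of the jump graph or to points.
  let ρ : StarVertex S m → V
    | .old x => x
    | .arm j s _ _ => if s = v then c j else s
    | .center j => c j
  have hρ : ∀ a b, StarRel X S m a b → a ≠ .old v → b ≠ .old v →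
      (ρ a = ρ b ∧ (ρ a = v → a.star = b.star)) ∨
        ((jumpGraph X S).Adj (ρ a) (ρ b) ∧ ρ a ≠ v ∧ ρ b ≠ v) := by
    intro a b hab ha hb
    cases hab with
    | old x y hxy =>
      exact Or.inr ⟨jumpGraph_adj.2 (Or.inl hxy), fun e => ha (congrArg _ e),
        fun e => hb (congrArg _ e)⟩
    | base j s hs =>
      have hsv : s ≠ v := fun e => ha (congrArg _ e)
      exact Or.inl ⟨by simp [ρ, hsv], fun e => absurd e hsv⟩
    | step j s hs k => exact Or.inl ⟨rfl, fun _ => rfl⟩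
    | top j s hs =>
      by_cases hsv : s = v
      · exact Or.inl ⟨by simp [ρ, hsv], fun _ => rfl⟩
      · have hcj : c j ≠ v := fun e => hsv (hcv j e s hs)
        by_cases hsc : s = c j
        · exact Or.inl ⟨by simp [ρ, hsc], fun _ => rfl⟩
        · refine Or.inr ?_
          simp only [ρ, if_neg hsv]
          exact ⟨jumpGraph_adj.2 (Or.inr ⟨hsc, j, hs, hcS j⟩), hsv, hcj⟩
  have hρ' : ∀ a b, (starGraph X S m).Adj a b → a ≠ .old v → b ≠ .old v →
      (ρ a = ρ b ∧ (ρ a = v → a.star = b.star)) ∨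
        ((jumpGraph X S).Adj (ρ a) (ρ b) ∧ ρ a ≠ v ∧ ρ b ≠ v) := by
    intro a b hab ha hb
    rcases starGraph_adj.1 hab with h | h
    · exact hρ a b h ha hb
    · rcases hρ b a h hb ha with ⟨h1, h2⟩ | ⟨h1, h2, h3⟩
      · exact Or.inl ⟨h1.symm, fun e => (h2 (h1.trans e)).symm⟩
      · exact Or.inr ⟨h1.symm, h3, h2⟩
  have hmap : ∀ w, Avoids (starGraph X S m) (.old v) n a w →
      Avoids (jumpGraph X S) v n (ρ a) (ρ w) ∨ (ρ a = v ∧ a.star = w.star) := by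
    intro w haw
    refine Avoids.head_induction (P := fun n a => Avoids (jumpGraph X S) v n (ρ a) (ρ w) ∨
      (ρ a = v ∧ a.star = w.star)) ?_ ?_ haw
    · intro hw n
      by_cases hwv : ρ w = v
      · exact Or.inr ⟨hwv, rfl⟩
      · exact Or.inl (.refl hwv n)
    · intro n a a' hadj ha ha' ih
      rcases hρ' a a' hadj ha ha'.left_ne with ⟨h1, h2⟩ | ⟨h1, h2, h3⟩
      · rcases ih with ih | ⟨ih, ih'⟩
        · exact Or.inl (h1 ▸ ih.mono (Nat.le_succ n))
        · exact Or.inr ⟨h1.trans ih, (h2 (h1.trans ih)).trans ih'⟩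
      · rcases ih with ih | ⟨ih, -⟩
        · rw [add_comm]
          exact Or.inl ((Avoids.of_adj h1 h2 h3).trans ih)
        · exact absurd ih h3
  have hfin : ((StarVertex.old '' {w | X.Adj v w ∧ Avoids (jumpGraph X S) v n (ρ a) w}) ∪
      ⋃ j ∈ {j | v ∈ S j ∧ ∃ c ∈ S j, Avoids (jumpGraph X S) v n (ρ a) c} ∪ {j | a.star = some j},
        ⋃ hs : v ∈ S j, {StarVertex.arm j v hs (0 : Fin (m + 1))}).Finite := by
    refine ((h.finite_avoids_jump hX v (ρ a) n).image _).union (Set.Finite.biUnion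
      ((h.finite_index_avoids_jump hX v (ρ a) n).union (Set.Subsingleton.finite ?_))
      fun j _ => Set.finite_iUnion fun hs => Set.finite_singleton _)
    intro j hj j' hj'
    exact Option.some_injective _ (hj.symm.trans hj')
  refine hfin.subset ?_
  rintro w ⟨hw, haw⟩
  have harm : ∀ j (hs : v ∈ S j), w = .arm j v hs 0 → w ∈
      ⋃ j ∈ {j | v ∈ S j ∧ ∃ c ∈ S j, Avoids (jumpGraph X S) v n (ρ a) c} ∪ {j | a.star = some j},
        ⋃ hs : v ∈ S j, {StarVertex.arm j v hs (0 : Fin (m + 1))} := by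
    rintro j hs rfl
    simp only [Set.mem_iUnion]
    refine ⟨j, ?_, hs, rfl⟩
    rcases hmap _ haw with h1 | ⟨-, h1⟩
    · exact Or.inl ⟨hs, c j, hcS j, by simpa [ρ] using h1⟩
    · exact Or.inr h1
  have hold : ∀ y, X.Adj v y → w = .old y →
      w ∈ StarVertex.old '' {w | X.Adj v w ∧ Avoids (jumpGraph X S) v n (ρ a) w} := by
    rintro y hy rfl
    refine ⟨y, ⟨hy, ?_⟩, rfl⟩
    rcases hmap _ haw with h1 | ⟨h1, h2⟩
    · exact h1
    · -- an old vertex other than `v` never collapses to `v`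
      exfalso
      cases a with
      | old x => exact haw.left_ne (congrArg _ h1)
      | arm => simp [StarVertex.star] at h2
      | center => simp [StarVertex.star] at h2
  rcases starGraph_adj.1 hw with h1 | h1
  · cases h1 with
    | old _ y hy => exact Or.inl (hold y hy rfl)
    | base j _ hs => exact Or.inr (harm j hs rfl)
  · cases h1 with
    | old y _ hy => exact Or.inl (hold y hy.symm rfl)

end starGraph

/-! ### Actions with open stabilizers -/

theorem edgeStabilizer_comm {G Z : Type*} [Group G] [MulAction G Z] (x y : Z) :
    edgeStabilizer G x y = edgeStabilizer G y x := by
  ext g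
  rw [edgeStabilizer, edgeStabilizer, Set.mem_ofPred_eq, Set.mem_ofPred_eq, Sym2.eq_swap,
    Sym2.eq_swap (a := x)]

section Action

variable {G : Type*} [Group G] [TopologicalSpace G] [IsTopologicalGroup G]
  {Z : Type*} [MulAction G Z]

theorem isOpen_stabilizer_smul {z : Z} (h : IsOpen (MulAction.stabilizer G z : Set G)) (g : G) :
    IsOpen (MulAction.stabilizer G (g • z) : Set G) := by
  have hc : Continuous fun k : G => g⁻¹ * k * g := by fun_prop
  convert h.preimage hc using 1
  ext k
  simp [MulAction.mem_stabilizer_iff, mul_smul, inv_smul_eq_iff]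

theorem isCompact_stabilizer_smul {z : Z} (h : IsCompact (MulAction.stabilizer G z : Set G))
    (g : G) : IsCompact (MulAction.stabilizer G (g • z) : Set G) := by
  have hc : Continuous fun k : G => g * k * g⁻¹ := by fun_prop
  convert h.image hc using 1
  ext k
  simp only [SetLike.mem_coe, MulAction.mem_stabilizer_iff, Set.mem_image]
  constructor
  · intro hk
    exact ⟨g⁻¹ * k * g, by simp [mul_smul, hk], by group⟩
  · rintro ⟨l, hl, rfl⟩
    simp [mul_smul, hl]

theorem isClosed_edgeStabilizer {x y : Z} (hx : IsOpen (MulAction.stabilizer G x : Set G))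
    (hy : IsOpen (MulAction.stabilizer G y : Set G)) : IsClosed (edgeStabilizer G x y) := by
  rw [← isOpen_compl_iff, isOpen_iff_mem_nhds]
  intro g hg
  have hc : Continuous fun k : G => g⁻¹ * k := by fun_prop
  have ho : IsOpen ((fun k : G => g⁻¹ * k) ⁻¹'
      (MulAction.stabilizer G x ∩ MulAction.stabilizer G y : Set G)) := (hx.inter hy).preimage hc
  refine Filter.mem_of_superset (ho.mem_nhds ?_) fun k hk hk' => hg ?_
  · simp
  · obtain ⟨h1, h2⟩ := hk
    simp only [SetLike.mem_coe, MulAction.mem_stabilizer_iff, mul_smul, inv_smul_eq_iff] at h1 h2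
    rw [edgeStabilizer, Set.mem_ofPred_eq] at hk' ⊢
    rw [← h1, ← h2, hk']

/-- A compact set moves a point with open stabilizer to finitely many points only. -/
theorem finite_image_smul {K : Set G} (hK : IsCompact K) {z : Z}
    (hz : IsOpen (MulAction.stabilizer G z : Set G)) : ((fun k => k • z) '' K).Finite := by
  let _ : TopologicalSpace Z := ⊥
  have : DiscreteTopology Z := ⟨rfl⟩
  refine (hK.image ?_).finite_of_discrete
  rw [continuous_discrete_rng]
  intro w
  rw [isOpen_iff_mem_nhds]
  rintro g rfl
  have hc : Continuous fun k : G => g⁻¹ * k := by fun_prop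
  refine Filter.mem_of_superset ((hz.preimage hc).mem_nhds ?_) fun k hk => ?_
  · simp
  · simpa [MulAction.mem_stabilizer_iff, mul_smul, inv_smul_eq_iff] using hk

end Action

/-! ### Group actions on graphs with stars -/

section StarAction

variable {G : Type u} [Group G] {V J : Type u} [MulAction G V] [MulAction G J]
  {X : SimpleGraph V} {S : J → Set V} {m : ℕ}

/-- The action on a graph with stars when the family `S` is equivariant. -/
@[reducible] def starAction (hS : ∀ (g : G) j s, s ∈ S j → g • s ∈ S (g • j)) (m : ℕ) :
    MulAction G (StarVertex S m) where
  smul g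
    | .old x => .old (g • x)
    | .arm j s hs k => .arm (g • j) (g • s) (hS g j s hs) k
    | .center j => .center (g • j)
  one_smul a := by
    cases a with
    | old x => exact congrArg StarVertex.old (one_smul G x)
    | arm j s hs k =>
      change StarVertex.arm _ _ _ _ = _
      simp only [one_smul]
    | center j => exact congrArg StarVertex.center (one_smul G j)
  mul_smul g h a := by
    cases a with
    | old x => exact congrArg StarVertex.old (mul_smul g h x)
    | arm j s hs k =>
      change StarVertex.arm _ _ _ _ = StarVertex.arm _ _ _ _
      simp only [mul_smul]
    | center j => exact congrArg StarVertex.center (mul_smul g h j)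

theorem StarRel.smul (hS : ∀ (g : G) j s, s ∈ S j → g • s ∈ S (g • j))
    (hX : ∀ (g : G) x y, X.Adj x y → X.Adj (g • x) (g • y)) (g : G) {a b : StarVertex S m}
    (h : StarRel X S m a b) :
    letI := starAction hS m
    StarRel X S m (g • a) (g • b) := by
  cases h with
  | old x y h => exact .old _ _ (hX g x y h)
  | base j s hs => exact .base _ _ _
  | step j s hs k => exact .step _ _ _ k
  | top j s hs => exact .top _ _ _

end StarAction

/-! ### A vertex with prescribed compact open stabilizer -/

section CosetStars

variable {G : Type u} [Group G] {V : Type u} [MulAction G V]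

/-- The subset of the orbit of `x₀` that corresponds to a coset of `U`. -/
def cosetOrbit (U : Subgroup G) (x₀ : V) (j : G ⧸ U) : Set V :=
  {x | ∃ g : G, (g : G ⧸ U) = j ∧ x = g • x₀}

theorem smul_mem_cosetOrbit (U : Subgroup G) (x₀ : V) (g : G) (j : G ⧸ U) (s : V)
    (hs : s ∈ cosetOrbit U x₀ j) : g • s ∈ cosetOrbit U x₀ (g • j) := by
  obtain ⟨k, rfl, rfl⟩ := hs
  exact ⟨g * k, rfl, (mul_smul _ _ _).symm⟩

theorem cosetOrbit_nonempty (U : Subgroup G) (x₀ : V) (j : G ⧸ U) :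
    (cosetOrbit U x₀ j).Nonempty := by
  obtain ⟨g, rfl⟩ := QuotientGroup.mk_surjective j
  exact ⟨_, g, rfl, rfl⟩

/-- The edges on short embedded paths between the points of `cosetOrbit U x₀ j`. -/
def cosetEdges (X : SimpleGraph V) (U : Subgroup G) (x₀ : V) (D : ℕ) (j : G ⧸ U) : Set (Sym2 V) :=
  {e | ∃ s ∈ cosetOrbit U x₀ j, ∃ t ∈ cosetOrbit U x₀ j, ∃ p : X.Walk s t,
    p.IsPath ∧ p.length ≤ D ∧ e ∈ p.edges}

/-- The automorphism of a graph given by a group element. -/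
def smulHom {X : SimpleGraph V} (hX : ∀ (g : G) x y, X.Adj x y → X.Adj (g • x) (g • y)) (g : G) :
    X →g X :=
  ⟨fun x => g • x, fun h => hX g _ _ h⟩

variable {X : SimpleGraph V} {U : Subgroup G} {x₀ : V} {D : ℕ}

theorem smul_mem_cosetEdges (hX : ∀ (g : G) x y, X.Adj x y → X.Adj (g • x) (g • y)) (g : G)
    {j : G ⧸ U} {e : Sym2 V} (he : e ∈ cosetEdges X U x₀ D j) :
    e.map (fun x => g • x) ∈ cosetEdges X U x₀ D (g • j) := by
  obtain ⟨s, hs, t, ht, p, hp, hl, he⟩ := he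
  exact ⟨g • s, smul_mem_cosetOrbit U x₀ g j s hs, g • t, smul_mem_cosetOrbit U x₀ g j t ht,
    p.map (smulHom hX g), hp.map (MulAction.injective g),
    (SimpleGraph.Walk.length_map (smulHom hX g) p).trans_le hl,
    (SimpleGraph.Walk.edges_map (smulHom hX g) p).symm ▸ List.mem_map_of_mem he⟩

theorem dist_smul (hX : ∀ (g : G) x y, X.Adj x y → X.Adj (g • x) (g • y)) (hconn : X.Connected)
    (g : G) (x y : V) : X.dist (g • x) (g • y) = X.dist x y := by
  have hle : ∀ (g : G) x y, X.dist (g • x) (g • y) ≤ X.dist x y := by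
    intro g x y
    obtain ⟨p, hp⟩ := hconn.exists_walk_length_eq_dist x y
    rw [← hp, ← SimpleGraph.Walk.length_map (smulHom hX g) p]
    exact SimpleGraph.dist_le _
  refine le_antisymm (hle g x y) ?_
  simpa using hle g⁻¹ (g • x) (g • y)

variable [TopologicalSpace G] [IsTopologicalGroup G]

theorem cosetOrbit_finite (hU : IsCompact (U : Set G))
    (hx₀ : IsOpen (MulAction.stabilizer G x₀ : Set G)) (j : G ⧸ U) :
    (cosetOrbit U x₀ j).Finite := by
  obtain ⟨a, rfl⟩ := QuotientGroup.mk_surjective j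
  refine ((finite_image_smul hU hx₀).image (fun x => a • x)).subset ?_
  rintro x ⟨g, hg, rfl⟩
  exact ⟨_, ⟨a⁻¹ * g, QuotientGroup.eq.1 hg.symm, rfl⟩, by simp [mul_smul]⟩

theorem exists_dist_cosetOrbit_le (hX : ∀ (g : G) x y, X.Adj x y → X.Adj (g • x) (g • y))
    (hconn : X.Connected) (hU : IsCompact (U : Set G))
    (hx₀ : IsOpen (MulAction.stabilizer G x₀ : Set G)) :
    ∃ D, ∀ j : G ⧸ U, ∀ s ∈ cosetOrbit U x₀ j, ∀ t ∈ cosetOrbit U x₀ j, X.dist s t ≤ D := by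
  have hfin := cosetOrbit_finite hU hx₀ ((1 : G) : G ⧸ U)
  obtain ⟨D, hD⟩ := ((hfin.prod hfin).image fun p => X.dist p.1 p.2).bddAbove
  refine ⟨D, fun j s hs t ht => ?_⟩
  obtain ⟨a, rfl⟩ := QuotientGroup.mk_surjective j
  have hone : a⁻¹ • (a : G ⧸ U) = ((1 : G) : G ⧸ U) :=
    congrArg QuotientGroup.mk (inv_mul_cancel a)
  rw [← dist_smul hX hconn a⁻¹]
  refine hD ⟨(a⁻¹ • s, a⁻¹ • t), ⟨?_, ?_⟩, rfl⟩
  · exact hone ▸ smul_mem_cosetOrbit U x₀ a⁻¹ _ s hs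
  · exact hone ▸ smul_mem_cosetOrbit U x₀ a⁻¹ _ t ht

theorem isOpen_stabilizer_coset (hU : IsOpen (U : Set G)) (j : G ⧸ U) :
    IsOpen (MulAction.stabilizer G j : Set G) := by
  obtain ⟨a, rfl⟩ := QuotientGroup.mk_surjective j
  have := isOpen_stabilizer_smul (z := ((1 : G) : G ⧸ U))
    (by rwa [MulAction.stabilizer_quotient]) a
  rwa [show a • ((1 : G) : G ⧸ U) = (a : G ⧸ U) from congrArg QuotientGroup.mk (mul_one a)] at this

theorem isCompact_stabilizer_coset (hU : IsCompact (U : Set G)) (j : G ⧸ U) :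
    IsCompact (MulAction.stabilizer G j : Set G) := by
  obtain ⟨a, rfl⟩ := QuotientGroup.mk_surjective j
  have := isCompact_stabilizer_smul (z := ((1 : G) : G ⧸ U))
    (by rwa [MulAction.stabilizer_quotient]) a
  rwa [show a • ((1 : G) : G ⧸ U) = (a : G ⧸ U) from congrArg QuotientGroup.mk (mul_one a)] at this

theorem cosetEdges_finite (hfine : IsFine X) (hU : IsCompact (U : Set G))
    (hx₀ : IsOpen (MulAction.stabilizer G x₀ : Set G)) (j : G ⧸ U) :
    (cosetEdges X U x₀ D j).Finite := by
  have hfin := cosetOrbit_finite hU hx₀ j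
  have : (⋃ s ∈ cosetOrbit U x₀ j, ⋃ t ∈ cosetOrbit U x₀ j, ⋃ n ∈ Set.Iic D,
      ⋃ p ∈ {p : X.Walk s t | p.IsPath ∧ p.length = n}, {e | e ∈ p.edges}).Finite :=
    hfin.biUnion fun s _ => hfin.biUnion fun t _ => (Set.finite_Iic D).biUnion fun n _ =>
      (hfine s t n).biUnion fun p _ => List.finite_toSet _
  refine this.subset ?_
  rintro e ⟨s, hs, t, ht, p, hp, hl, he⟩
  simp only [Set.mem_iUnion]
  exact ⟨s, hs, t, ht, p.length, hl, p, ⟨hp, rfl⟩, he⟩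

/-- Only finitely many cosets use a given edge: the cosets that use it through a fixed edge of the
trivial coset form an orbit of its compact stabilizer. -/
theorem finite_index_cosetEdges (hX : ∀ (g : G) x y, X.Adj x y → X.Adj (g • x) (g • y))
    (hfine : IsFine X) (hU : IsCompact (U : Set G)) (hUo : IsOpen (U : Set G))
    (hx₀ : IsOpen (MulAction.stabilizer G x₀ : Set G))
    (hedge : ∀ x y : V, X.Adj x y → IsCompact (edgeStabilizer G x y)) (e : Sym2 V)
    (he : e ∈ X.edgeSet) : {j | e ∈ cosetEdges X U x₀ D j}.Finite := by
  induction e with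
  | _ x y =>
  rw [SimpleGraph.mem_edgeSet] at he
  have hfin : (⋃ e₀ ∈ cosetEdges X U x₀ D ((1 : G) : G ⧸ U),
      {j : G ⧸ U | ∃ g : G, (g : G ⧸ U) = j ∧ e₀.map (fun z => g • z) = s(x, y)}).Finite := by
    refine (cosetEdges_finite hfine hU hx₀ _).biUnion fun e₀ _ => ?_
    rcases Set.eq_empty_or_nonempty
      {j : G ⧸ U | ∃ g : G, (g : G ⧸ U) = j ∧ e₀.map (fun z => g • z) = s(x, y)} with h | ⟨j, hj⟩
    · rw [h]
      exact Set.finite_empty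
    · obtain ⟨g, rfl, hg⟩ := hj
      refine (finite_image_smul (hedge x y he)
        (isOpen_stabilizer_coset hUo (g : G ⧸ U))).subset ?_
      rintro j ⟨k, rfl, hk⟩
      refine ⟨k * g⁻¹, ?_, ?_⟩
      · rw [edgeStabilizer, Set.mem_ofPred_eq, ← Sym2.map_mk (fun z => (k * g⁻¹) • z), ← hg,
          Sym2.map_map, hg, ← hk]
        congr 1
        ext z
        simp [mul_smul]
      · change (((k * g⁻¹) * g : G) : G ⧸ U) = k
        rw [inv_mul_cancel_right]
  refine hfin.subset fun j hj => ?_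
  obtain ⟨a, rfl⟩ := QuotientGroup.mk_surjective j
  have h1 := smul_mem_cosetEdges hX a⁻¹ hj
  rw [show a⁻¹ • (a : G ⧸ U) = ((1 : G) : G ⧸ U) from
    congrArg QuotientGroup.mk (inv_mul_cancel a)] at h1
  refine Set.mem_biUnion h1 ⟨a, rfl, ?_⟩
  rw [Sym2.map_map]
  simp

theorem isSpanned_cosetOrbit (hX : ∀ (g : G) x y, X.Adj x y → X.Adj (g • x) (g • y))
    (hconn : X.Connected) (hfine : IsFine X) (hU : IsCompact (U : Set G))
    (hUo : IsOpen (U : Set G)) (hx₀ : IsOpen (MulAction.stabilizer G x₀ : Set G))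
    (hedge : ∀ x y : V, X.Adj x y → IsCompact (edgeStabilizer G x y))
    (hD : ∀ j : G ⧸ U, ∀ s ∈ cosetOrbit U x₀ j, ∀ t ∈ cosetOrbit U x₀ j, X.dist s t ≤ D) :
    IsSpanned X (cosetOrbit U x₀) (cosetEdges X U x₀ D) D where
  exists_walk j a ha b hb := by
    obtain ⟨p, hp, hl⟩ := hconn.exists_path_of_dist a b
    have hl' : p.length ≤ D := hl ▸ hD j a ha b hb
    exact ⟨p, hl', fun e he => ⟨a, ha, b, hb, p, hp, hl', he⟩⟩
  finite := cosetOrbit_finite hU hx₀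
  nonempty := cosetOrbit_nonempty U x₀
  finite_index := finite_index_cosetEdges hX hfine hU hUo hx₀ hedge

/-- Every compact open subgroup is a vertex stabilizer in some fine hyperbolic Cayley-Abels graph:
attach to a given graph stars indexed by the cosets of the subgroup, with long arms. -/
theorem exists_cayleyAbels_stabilizer_eq {ℋ : Set (Subgroup G)} (hCA : IsCayleyAbelsGraph ℋ X)
    (hfine : IsFine X) (hhyp : IsHyperbolicGraph X) (U : Subgroup G) (hU : IsCompact (U : Set G))
    (hUo : IsOpen (U : Set G)) :
    ∃ (W : Type u) (_ : MulAction G W) (Y : SimpleGraph W), IsCayleyAbelsGraph ℋ Y ∧ IsFine Y ∧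
      IsHyperbolicGraph Y ∧ ∃ p : W, MulAction.stabilizer G p = U := by
  have hX := hCA.adj_smul
  obtain ⟨x₀⟩ := hCA.connected.nonempty
  have hx₀ := hCA.isOpen_stabilizer x₀
  obtain ⟨D, hD⟩ := exists_dist_cosetOrbit_le hX hCA.connected hU hx₀
  have hspan := isSpanned_cosetOrbit hX hCA.connected hfine hU hUo hx₀ hCA.isCompact_edge hD
  have hS := smul_mem_cosetOrbit U x₀
  let o : G ⧸ U := ((1 : G) : G ⧸ U)
  have ho : x₀ ∈ cosetOrbit U x₀ o := ⟨1, rfl, (one_smul G x₀).symm⟩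
  let act := starAction hS D
  let Y := starGraph X (cosetOrbit U x₀) D
  have hold : ∀ (g : G) x, g • (StarVertex.old x : StarVertex (cosetOrbit U x₀) D) =
      .old (g • x) := fun _ _ => rfl
  have hcenter : ∀ (g : G) j, g • (StarVertex.center j : StarVertex (cosetOrbit U x₀) D) =
      .center (g • j) := fun _ _ => rfl
  have harm : ∀ (g : G) j s hs k, g • (StarVertex.arm j s hs k : StarVertex (cosetOrbit U x₀) D) =
      .arm (g • j) (g • s) (hS g j s hs) k := fun _ _ _ _ _ => rfl
  have hstar : ∀ (g : G) (a : StarVertex (cosetOrbit U x₀) D),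
      (g • a).star = a.star.map (fun j => g • j) := by
    intro g a
    cases a <;> rfl
  have hmk : ∀ g : G, (g : G ⧸ U) = g • o := fun g => congrArg QuotientGroup.mk (mul_one g).symm
  -- `Q` is the star of the trivial coset with a single arm
  let Q : Set (StarVertex (cosetOrbit U x₀) D) :=
    insert (.old x₀) (insert (.center o) (Set.range (StarVertex.arm o x₀ ho)))
  have hQfin : Q.Finite := ((Set.finite_range _).insert _).insert _
  have hQarm : ∀ j s hs, ∃ g : G, g⁻¹ • j = o ∧ g⁻¹ • s = x₀ ∧
      ∀ k, g⁻¹ • (StarVertex.arm j s hs k : StarVertex (cosetOrbit U x₀) D) =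
        .arm o x₀ ho k := by
    intro j s hs
    obtain ⟨g, h1, h2⟩ := id hs
    have e1 : g⁻¹ • j = o := by rw [← h1, hmk, inv_smul_smul]
    have e2 : g⁻¹ • s = x₀ := by rw [h2, inv_smul_smul]
    refine ⟨g, e1, e2, fun k => ?_⟩
    rw [harm]
    simp only [e1, e2]
  have hQedge : ∀ a b, StarRel X (cosetOrbit U x₀) D a b →
      (∃ x y, X.Adj x y ∧ a = .old x ∧ b = .old y) ∨
      ∃ j, b.star = some j ∧ (∀ i, a.star = some i → i = j) ∧
        ∃ g : G, g • a ∈ Q ∧ g • b ∈ Q := by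
    intro a b hab
    cases hab with
    | old x y h => exact Or.inl ⟨x, y, h, rfl, rfl⟩
    | base j s hs =>
      obtain ⟨g, h1, h2, h3⟩ := hQarm j s hs
      refine Or.inr ⟨j, rfl, fun i hi => by simp [StarVertex.star] at hi, g⁻¹, ?_, ?_⟩
      · rw [hold, h2]
        exact Or.inl rfl
      · rw [h3]
        exact Or.inr (Or.inr ⟨_, rfl⟩)
    | step j s hs k =>
      obtain ⟨g, h1, h2, h3⟩ := hQarm j s hs
      refine Or.inr ⟨j, rfl, fun i hi => (Option.some_injective _ hi).symm, g⁻¹, ?_, ?_⟩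
      · rw [h3]
        exact Or.inr (Or.inr ⟨_, rfl⟩)
      · rw [h3]
        exact Or.inr (Or.inr ⟨_, rfl⟩)
    | top j s hs =>
      obtain ⟨g, h1, h2, h3⟩ := hQarm j s hs
      refine Or.inr ⟨j, rfl, fun i hi => (Option.some_injective _ hi).symm, g⁻¹, ?_, ?_⟩
      · rw [h3]
        exact Or.inr (Or.inr ⟨_, rfl⟩)
      · rw [hcenter, h1]
        exact Or.inr (Or.inl rfl)
  have hstabOld : ∀ x, MulAction.stabilizer G
      (StarVertex.old x : StarVertex (cosetOrbit U x₀) D) = MulAction.stabilizer G x := by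
    intro x
    ext g
    simp [MulAction.mem_stabilizer_iff, hold]
  have hstabCenter : ∀ j, MulAction.stabilizer G
      (StarVertex.center j : StarVertex (cosetOrbit U x₀) D) = MulAction.stabilizer G j := by
    intro j
    ext g
    simp [MulAction.mem_stabilizer_iff, hcenter]
  have hstabArm : ∀ j s hs k, MulAction.stabilizer G
      (StarVertex.arm j s hs k : StarVertex (cosetOrbit U x₀) D) =
        MulAction.stabilizer G j ⊓ MulAction.stabilizer G s := by
    intro j s hs k
    ext g
    simp [MulAction.mem_stabilizer_iff, harm]
  have hopen : ∀ a : StarVertex (cosetOrbit U x₀) D,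
      IsOpen (MulAction.stabilizer G a : Set G) := by
    intro a
    cases a with
    | old x =>
      rw [hstabOld]
      exact hCA.isOpen_stabilizer x
    | arm j s hs k =>
      rw [hstabArm]
      exact (isOpen_stabilizer_coset hUo j).inter (hCA.isOpen_stabilizer s)
    | center j =>
      rw [hstabCenter]
      exact isOpen_stabilizer_coset hUo j
  have hcomp : ∀ (a : StarVertex (cosetOrbit U x₀) D) j, a.star = some j →
      IsCompact (MulAction.stabilizer G a : Set G) := by
    intro a j ha
    refine (isCompact_stabilizer_coset hU j).of_isClosed_subset
      (Subgroup.isClosed_of_isOpen _ (hopen a)) fun g hg => ?_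
    have h1 := hstar g a
    rw [show g • a = a from hg, ha] at h1
    exact (Option.some_injective _ h1).symm
  have hcompEdge : ∀ a b, StarRel X (cosetOrbit U x₀) D a b →
      IsCompact (edgeStabilizer G a b) := by
    intro a b hab
    rcases hQedge a b hab with ⟨x, y, hxy, rfl, rfl⟩ | ⟨j, hb, ha, -⟩
    · convert hCA.isCompact_edge x y hxy using 1
      ext g
      simp [edgeStabilizer, hold]
    · refine (isCompact_stabilizer_coset hU j).of_isClosed_subset
        (isClosed_edgeStabilizer (hopen a) (hopen b)) fun g hg => ?_
      rw [edgeStabilizer, Set.mem_ofPred_eq, Sym2.eq_iff] at hg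
      have h1 := hstar g b
      rw [hb] at h1
      rcases hg with ⟨-, hg⟩ | ⟨-, hg⟩
      · rw [hg, hb] at h1
        exact (Option.some_injective _ h1).symm
      · rw [hg] at h1
        exact ha _ h1
  refine ⟨StarVertex (cosetOrbit U x₀) D, act, Y, ?_, ?_, ?_, .center o, ?_⟩
  · refine
      { adj_smul := fun g a b hab => ?_
        connected := starGraph_connected hCA.connected (cosetOrbit_nonempty U x₀)
        finite_vertex_orbits := ?_
        finite_edge_orbits := ?_
        isOpen_stabilizer := hopen
        isCompact_edge := fun a b hab => ?_
        vertex_stabilizer := fun a => ?_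
        exists_vertex := fun K hK => ?_
        same_orbit := fun K hK hKc a b ha hb => ?_ }
    · rcases starGraph_adj.1 hab with h | h
      · exact starGraph_adj.2 (Or.inl (h.smul hS hX g))
      · exact starGraph_adj.2 (Or.inr (h.smul hS hX g))
    · obtain ⟨F, hF, hF'⟩ := hCA.finite_vertex_orbits
      refine ⟨StarVertex.old '' F ∪ Q, (hF.image _).union hQfin, fun a => ?_⟩
      cases a with
      | old x =>
        obtain ⟨g, hg⟩ := hF' x
        exact ⟨g, Or.inl ⟨_, hg, rfl⟩⟩
      | arm j s hs k =>
        obtain ⟨g, -, -, hg⟩ := hQarm j s hs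
        exact ⟨g⁻¹, Or.inr (Or.inr (Or.inr ⟨k, (hg k).symm⟩))⟩
      | center j =>
        obtain ⟨g, rfl⟩ := QuotientGroup.mk_surjective j
        refine ⟨g⁻¹, Or.inr (Or.inr (Or.inl ?_))⟩
        rw [hcenter, hmk, inv_smul_smul]
    · obtain ⟨F, hF, hF'⟩ := hCA.finite_edge_orbits
      refine ⟨(fun p => (StarVertex.old p.1, StarVertex.old p.2)) '' F ∪ Q ×ˢ Q,
        (hF.image _).union (hQfin.prod hQfin), fun a b hab => ?_⟩
      rcases starGraph_adj.1 hab with h | h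
      · rcases hQedge a b h with ⟨x, y, hxy, rfl, rfl⟩ | ⟨j, -, -, g, h1, h2⟩
        · obtain ⟨g, hg⟩ := hF' x y hxy
          exact ⟨g, Or.inl ⟨_, hg, rfl⟩⟩
        · exact ⟨g, Or.inr ⟨h1, h2⟩⟩
      · rcases hQedge b a h with ⟨x, y, hxy, rfl, rfl⟩ | ⟨j, -, -, g, h1, h2⟩
        · obtain ⟨g, hg⟩ := hF' y x hxy.symm
          exact ⟨g, Or.inl ⟨_, hg, rfl⟩⟩
        · exact ⟨g, Or.inr ⟨h2, h1⟩⟩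
    · rcases starGraph_adj.1 hab with h | h
      · exact hcompEdge a b h
      · rw [edgeStabilizer_comm]
        exact hcompEdge b a h
    · cases a with
      | old x =>
        rw [hstabOld]
        exact hCA.vertex_stabilizer x
      | arm j s hs k => exact Or.inl (hcomp _ j rfl)
      | center j => exact Or.inl (hcomp _ j rfl)
    · obtain ⟨x, hx⟩ := hCA.exists_vertex K hK
      exact ⟨.old x, (hstabOld x).trans hx⟩
    · cases a with
      | old x =>
        cases b with
        | old y =>
          rw [hstabOld] at ha hb
          obtain ⟨g, hg⟩ := hCA.same_orbit K hK hKc x y ha hb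
          exact ⟨g, congrArg StarVertex.old hg⟩
        | arm j s hs k => exact absurd (hb ▸ hcomp _ j rfl) hKc
        | center j => exact absurd (hb ▸ hcomp _ j rfl) hKc
      | arm j s hs k => exact absurd (ha ▸ hcomp _ j rfl) hKc
      | center j => exact absurd (ha ▸ hcomp _ j rfl) hKc
  · exact starGraph_isFine hspan hfine
  · refine starGraph_isHyperbolic hCA.connected hhyp hspan.finite hspan.nonempty
      fun j s hs t ht => (hD j s hs t ht).trans (by omega)
  · rw [hstabCenter]
    exact MulAction.stabilizer_quotient U

end CosetStars

open Monoid

/-! ### The projection of an amalgam onto the cosets of a factor -/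

section Projection

variable {ι : Type*} {H : ι → Type*} {K : Type*} [∀ i, Group (H i)] [Group K]
  {φ : ∀ i, K →* H i}

/-- Induction on elements of an amalgam by multiplication on the right with elements of the
factors. -/
theorem pushout_right_induction [Nonempty ι] {P : PushoutI φ → Prop} (one : P 1)
    (mul : ∀ g i (h : H i), P g → P (g * PushoutI.of i h)) (g : PushoutI φ) : P g := by
  suffices h : ∀ x : PushoutI φ, ∀ g, P g → P (g * x) by simpa using h g 1 one
  intro x
  induction x using PushoutI.induction_on with
  | of i h => exact fun g hg => mul g i h hg
  | base c =>
    intro g hg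
    rw [← PushoutI.of_apply_eq_base φ (Classical.arbitrary ι) c]
    exact mul g _ _ hg
  | mul x y hx hy =>
    intro g hg
    rw [← mul_assoc]
    exact hy _ (hx g hg)

/-- The permutation action of a group `G` on `G × M` by right translations, twisted by the
coboundary of a function `χ : G → M`. -/
def twistedTranslation {G M : Type*} [Group G] [AddCommGroup M] (χ : G → M) :
    G →* Equiv.Perm (G × M) where
  toFun x :=
    { toFun := fun a => (a.1 * x⁻¹, a.2 + (χ (a.1 * x⁻¹) - χ a.1))
      invFun := fun a => (a.1 * x, a.2 + (χ (a.1 * x) - χ a.1))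
      left_inv := fun a => Prod.ext (by simp) (by simp only [inv_mul_cancel_right]; abel)
      right_inv := fun a => Prod.ext (by simp) (by simp only [mul_inv_cancel_right]; abel) }
  map_one' := by ext a <;> simp
  map_mul' x y := by
    ext a
    · simp [mul_assoc]
    · simp only [Equiv.Perm.mul_apply, Equiv.coe_fn_mk, mul_inv_rev, mul_assoc]
      abel

/-- Functions on the factors are glued to a function on the amalgam whose increments along each
factor are prescribed. The increments must vanish on the amalgamated subgroup. -/
theorem exists_function_of_increments [Nonempty ι] {M : Type*} [AddCommGroup M]
    (χ : ι → PushoutI φ → M) (hχ : ∀ i g c, χ i (g * PushoutI.base φ c) = χ i g) (m : M) :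
    ∃ F : PushoutI φ → M, F 1 = m ∧ ∀ g i (h : H i),
      F (g * PushoutI.of i h) = F g + (χ i (g * PushoutI.of i h) - χ i g) := by
  let Ψ : PushoutI φ →* Equiv.Perm (PushoutI φ × M) :=
    PushoutI.lift (fun i => (twistedTranslation (χ i)).comp (PushoutI.of i))
      ((twistedTranslation fun _ => (0 : M)).comp (PushoutI.base φ)) (by
        intro i
        ext c a <;> simp [twistedTranslation, PushoutI.of_apply_eq_base, ← map_inv, hχ])
  have hΨ : ∀ g i (h : H i) a, Ψ (g * PushoutI.of i h)⁻¹ a =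
      ((Ψ g⁻¹ a).1 * PushoutI.of i h, (Ψ g⁻¹ a).2 +
        (χ i ((Ψ g⁻¹ a).1 * PushoutI.of i h) - χ i (Ψ g⁻¹ a).1)) := by
    intro g i h a
    rw [mul_inv_rev, map_mul, Equiv.Perm.mul_apply, ← map_inv (PushoutI.of (φ := φ) i)]
    simp [Ψ, twistedTranslation]
  have h1 : ∀ g, (Ψ g⁻¹ (1, m)).1 = g := by
    intro g
    induction g using pushout_right_induction with
    | one => simp
    | mul g i h ih => rw [hΨ, ih]
  refine ⟨fun g => (Ψ g⁻¹ (1, m)).2, by simp, fun g i h => ?_⟩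
  simp only [hΨ, h1]

variable {i : ι} {V : Type*} [MulAction (H i) V]

/-- The function `r` sends an element of the amalgam to the translate of `p` by its first syllable
from the factor `H i`: it is determined by multiplication on the right, which only matters within
`H i`. -/
structure IsProjection (i : ι) [MulAction (H i) V] (p : V) (r : PushoutI φ → V) : Prop where
  of_self : ∀ h : H i, r (PushoutI.of i h) = h • p
  mul_of_ne : ∀ g j (h : H j), j ≠ i → r (g * PushoutI.of j h) = r g
  mul_of_notMem : ∀ g (h : H i), g ∉ (PushoutI.of (φ := φ) i).range →
    r (g * PushoutI.of i h) = r g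

/-- The projection exists. Its values are generators of a free abelian group, in which it solves the
equations for the increments along the factors. -/
theorem exists_isProjection [Nonempty ι] (hφ : ∀ i, Function.Injective (φ i)) (p : V)
    (hp : (φ i).range ≤ MulAction.stabilizer (H i) p) :
    ∃ r : PushoutI φ → V, IsProjection i p r := by
  classical
  let χ₀ : PushoutI φ → V →₀ ℤ := fun g =>
    if h : ∃ a : H i, PushoutI.of i a = g then Finsupp.single (h.choose • p) 1 else 0
  have hχof : ∀ a : H i, χ₀ (PushoutI.of i a) = Finsupp.single (a • p) 1 := by
    intro a
    have h : ∃ b : H i, PushoutI.of (φ := φ) i b = PushoutI.of i a := ⟨a, rfl⟩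
    have hb := PushoutI.of_injective hφ i h.choose_spec
    simp only [χ₀, dif_pos h]
    rw [hb]
  have hχnot : ∀ g, g ∉ (PushoutI.of (φ := φ) i).range → χ₀ g = 0 := fun g hg => dif_neg hg
  have hχbase : ∀ g c, χ₀ (g * PushoutI.base φ c) = χ₀ g := by
    intro g c
    rw [← PushoutI.of_apply_eq_base φ i c]
    by_cases hg : g ∈ (PushoutI.of (φ := φ) i).range
    · obtain ⟨a, rfl⟩ := hg
      rw [← map_mul, hχof, hχof, mul_smul, show φ i c • p = p from hp ⟨c, rfl⟩]
    · rw [hχnot g hg, hχnot]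
      intro h
      exact hg ((Subgroup.mul_mem_cancel_right _ (MonoidHom.mem_range.2 ⟨_, rfl⟩)).1 h)
  obtain ⟨F, hF1, hF⟩ := exists_function_of_increments
    (fun j => if j = i then χ₀ else 0) (fun j g c => by
      by_cases hj : j = i
      · simp [hj, hχbase]
      · simp [hj]) (Finsupp.single p (1 : ℤ))
  have hFne : ∀ g j (h : H j), j ≠ i → F (g * PushoutI.of j h) = F g := by
    intro g j h hj
    simp [hF, hj]
  have hFself : ∀ g (h : H i), F (g * PushoutI.of i h) =
      F g + (χ₀ (g * PushoutI.of i h) - χ₀ g) := by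
    intro g h
    simp [hF]
  have hFnot : ∀ g (h : H i), g ∉ (PushoutI.of (φ := φ) i).range →
      F (g * PushoutI.of i h) = F g := by
    intro g h hg
    rw [hFself, hχnot g hg, hχnot, sub_zero, add_zero]
    exact fun hgh => hg ((Subgroup.mul_mem_cancel_right _ (MonoidHom.mem_range.2 ⟨_, rfl⟩)).1 hgh)
  have hFof : ∀ a : H i, F (PushoutI.of i a) = Finsupp.single (a • p) 1 := by
    intro a
    have h1 : χ₀ 1 = Finsupp.single p 1 := by simpa using hχof 1
    have := hFself 1 a
    rw [one_mul, hF1, hχof, h1] at this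
    rw [this]
    abel
  have hval : ∀ g, ∃ w, F g = Finsupp.single w 1 := by
    intro g
    induction g using pushout_right_induction with
    | one => exact ⟨p, hF1⟩
    | mul g j h ih =>
      by_cases hj : j = i
      · subst hj
        by_cases hg : g ∈ (PushoutI.of (φ := φ) j).range
        · obtain ⟨a, rfl⟩ := hg
          rw [← map_mul]
          exact ⟨_, hFof _⟩
        · rwa [hFnot g h hg]
      · rwa [hFne g j h hj]
  choose r hr using hval
  have hr' : ∀ g w, F g = Finsupp.single w 1 → r g = w := fun g w h =>
    Finsupp.single_left_injective (one_ne_zero (α := ℤ)) ((hr g).symm.trans h)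
  exact ⟨r, fun h => hr' _ _ (hFof h), fun g j h hj => hr' _ _ ((hFne g j h hj).trans (hr g)),
    fun g h hg => hr' _ _ ((hFnot g h hg).trans (hr g))⟩

namespace IsProjection

variable {p : V} {r : PushoutI φ → V}

theorem one (hr : IsProjection i p r) : r 1 = p := by
  simpa using hr.of_self 1

theorem exists_smul [Nonempty ι] (hr : IsProjection i p r) (g : PushoutI φ) :
    ∃ a : H i, r g = a • p := by
  induction g using pushout_right_induction with
  | one => exact ⟨1, by rw [hr.one, one_smul]⟩
  | mul g j h ih =>
    by_cases hj : j = i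
    · subst hj
      by_cases hg : g ∈ (PushoutI.of (φ := φ) j).range
      · obtain ⟨a, rfl⟩ := hg
        exact ⟨a * h, by rw [← map_mul, hr.of_self]⟩
      · rwa [hr.mul_of_notMem g h hg]
    · rwa [hr.mul_of_ne g j h hj]

theorem of_mul [Nonempty ι] (hr : IsProjection i p r) (a : H i) (g : PushoutI φ) :
    r (PushoutI.of i a * g) = a • r g := by
  induction g using pushout_right_induction with
  | one => rw [mul_one, hr.of_self, hr.one]
  | mul g j h ih =>
    rw [← mul_assoc]
    by_cases hj : j = i
    · subst hj
      by_cases hg : g ∈ (PushoutI.of (φ := φ) j).range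
      · obtain ⟨b, rfl⟩ := hg
        rw [← map_mul, ← map_mul, ← map_mul, hr.of_self, hr.of_self, mul_assoc, mul_smul]
      · rw [hr.mul_of_notMem g h hg, hr.mul_of_notMem _ h, ih]
        exact fun h' => hg ((Subgroup.mul_mem_cancel_left _ (MonoidHom.mem_range.2 ⟨_, rfl⟩)).1 h')
    · rw [hr.mul_of_ne g j h hj, hr.mul_of_ne _ j h hj, ih]

end IsProjection

/-- An element of the amalgam all of whose projections are trivial lies in the amalgamated
subgroup. -/
theorem mem_base_of_projections [Nonempty ι] {V : ι → Type*} [∀ i, MulAction (H i) (V i)]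
    {p : ∀ i, V i} (hp : ∀ i, MulAction.stabilizer (H i) (p i) = (φ i).range)
    {r : ∀ i, PushoutI φ → V i} (hr : ∀ i, IsProjection i (p i) (r i)) (g : PushoutI φ)
    (hg : ∀ i, r i g = p i) : g ∈ (PushoutI.base φ).range := by
  induction g using pushout_right_induction with
  | one => exact one_mem _
  | mul g j h ih =>
    by_cases hgj : g ∈ (PushoutI.of (φ := φ) j).range
    · obtain ⟨a, rfl⟩ := hgj
      have := hg j
      rw [← map_mul, (hr j).of_self, ← MulAction.mem_stabilizer_iff, hp] at this
      obtain ⟨c, hc⟩ := this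
      exact ⟨c, by rw [← PushoutI.of_apply_eq_base φ j c, hc, map_mul]⟩
    · have hmem := ih fun i => by
        by_cases hij : j = i
        · subst hij
          rw [← (hr j).mul_of_notMem g h hgj, hg]
        · rw [← (hr i).mul_of_ne g j h hij, hg]
      obtain ⟨c, rfl⟩ := hmem
      exact absurd ⟨φ j c, PushoutI.of_apply_eq_base φ j c⟩ hgj

end Projection

/-! ### Induced actions -/

section Induced

variable {G H : Type*} [Group G] [Group H] (f : H →* G) (V : Type*) [MulAction H V]

/-- The equivalence relation on `G × V` generated by `(g * f h, x) ∼ (g, h • x)`. -/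
def inducedSetoid : Setoid (G × V) where
  r a b := ∃ h : H, b.1 = a.1 * f h ∧ a.2 = h • b.2
  iseqv :=
    { refl := fun a => ⟨1, by simp, by simp⟩
      symm := by
        rintro a b ⟨h, h1, h2⟩
        exact ⟨h⁻¹, by rw [h1]; simp, by rw [h2]; simp⟩
      trans := by
        rintro a b c ⟨h, h1, h2⟩ ⟨k, k1, k2⟩
        exact ⟨h * k, by rw [k1, h1, map_mul, mul_assoc], by rw [h2, k2, mul_smul]⟩ }

/-- The `G`-set `G ×_H V` induced from an `H`-set `V` along `f : H → G`. -/
def Induced : Type _ :=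
  Quotient (inducedSetoid f V)

namespace Induced

variable {V}

/-- The class of `(g, x)` in `G ×_H V`. -/
def mk (g : G) (x : V) : Induced f V :=
  Quotient.mk (inducedSetoid f V) (g, x)

variable {f}

theorem mk_eq_mk_iff {g g' : G} {x x' : V} :
    mk f g x = mk f g' x' ↔ ∃ h : H, g' = g * f h ∧ x = h • x' :=
  Quotient.eq (r := inducedSetoid f V)

theorem exists_rep (q : Induced f V) : ∃ g x, q = mk f g x := by
  induction q using Quotient.inductionOn with
  | h a => exact ⟨a.1, a.2, rfl⟩

theorem mk_mul (g : G) (h : H) (x : V) : mk f (g * f h) x = mk f g (h • x) :=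
  (mk_eq_mk_iff.2 ⟨h, rfl, rfl⟩).symm

theorem mk_injective (hf : Function.Injective f) (g : G) :
    Function.Injective (mk f g : V → Induced f V) := by
  intro x y hxy
  obtain ⟨h, h1, h2⟩ := mk_eq_mk_iff.1 hxy
  rw [left_eq_mul, map_eq_one_iff f hf] at h1
  rw [h2, h1, one_smul]

instance : MulAction G (Induced f V) where
  smul k := Quotient.map (fun a => (k * a.1, a.2)) (by
    rintro a b ⟨h, h1, h2⟩
    exact ⟨h, by rw [h1, mul_assoc], h2⟩)
  one_smul q := by
    obtain ⟨g, x, rfl⟩ := exists_rep q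
    exact congrArg (fun k => mk f k x) (one_mul g)
  mul_smul k l q := by
    obtain ⟨g, x, rfl⟩ := exists_rep q
    exact congrArg (fun k => mk f k x) (mul_assoc k l g)

theorem smul_mk (k g : G) (x : V) : k • mk f g x = mk f (k * g) x :=
  rfl

theorem stabilizer_mk (g : G) (x : V) : MulAction.stabilizer G (mk f g x) =
    ((MulAction.stabilizer H x).map f).map (MulAut.conj g).toMonoidHom := by
  ext k
  simp only [MulAction.mem_stabilizer_iff, smul_mk, mk_eq_mk_iff, Subgroup.mem_map]
  constructor
  · rintro ⟨h, h1, h2⟩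
    refine ⟨f h⁻¹, ⟨h⁻¹, by rw [inv_smul_eq_iff]; exact h2, rfl⟩, ?_⟩
    simp only [MulEquiv.coe_toMonoidHom, MulAut.conj_apply]
    nth_rewrite 1 [h1]
    simp [mul_assoc]
  · rintro ⟨-, ⟨h, h1, rfl⟩, rfl⟩
    exact ⟨h⁻¹, by simp [mul_assoc], by rw [eq_inv_smul_iff]; exact h1⟩

end Induced

end Induced

/-! ### The graph of an amalgam -/

section AmalgamGraph

variable {ι : Type} {H : ι → Type u} {K : Type v} [∀ i, Group (H i)] [Group K]
  {φ : ∀ i, K →* H i} {V : ι → Type u} [∀ i, MulAction (H i) (V i)]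

/-- The vertices of the graph of the amalgam: the translates of the vertices of the graphs of the
factors. -/
abbrev AmalgamVertex (φ : ∀ i, K →* H i) (V : ι → Type u) [∀ i, MulAction (H i) (V i)] :
    Type (max u v) :=
  Σ i, Induced (PushoutI.of (φ := φ) i) (V i)

/-- The vertex given by the translate by `g` of a vertex of the graph of the `i`-th factor. -/
def amalgamVertex (φ : ∀ i, K →* H i) (i : ι) (g : PushoutI φ) (x : V i) : AmalgamVertex φ V :=
  ⟨i, Induced.mk _ g x⟩

theorem smul_amalgamVertex (k : PushoutI φ) (i : ι) (g : PushoutI φ) (x : V i) :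
    k • amalgamVertex φ i g x = amalgamVertex φ i (k * g) x :=
  rfl

theorem exists_amalgamVertex (a : AmalgamVertex φ V) : ∃ i g x, a = amalgamVertex φ i g x := by
  obtain ⟨i, q⟩ := a
  obtain ⟨g, x, rfl⟩ := Induced.exists_rep q
  exact ⟨i, g, x, rfl⟩

theorem amalgamVertex_mul (i : ι) (g : PushoutI φ) (h : H i) (x : V i) :
    amalgamVertex φ i (g * PushoutI.of i h) x = amalgamVertex φ i g (h • x) :=
  congrArg (Sigma.mk i) (Induced.mk_mul g h x)

theorem amalgamVertex_eq_iff {i : ι} {g g' : PushoutI φ} {x x' : V i} :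
    amalgamVertex φ i g x = amalgamVertex φ i g' x' ↔
      ∃ h : H i, g' = g * PushoutI.of i h ∧ x = h • x' := by
  rw [← Induced.mk_eq_mk_iff]
  exact ⟨fun h => eq_of_heq (Sigma.mk.inj h).2, fun h => congrArg (Sigma.mk i) h⟩

theorem amalgamVertex_injective (hφ : ∀ i, Function.Injective (φ i)) (i : ι) (g : PushoutI φ) :
    Function.Injective (amalgamVertex φ i g : V i → AmalgamVertex φ V) := fun _ _ h =>
  Induced.mk_injective (PushoutI.of_injective hφ i) g (eq_of_heq (Sigma.mk.inj h).2)

theorem stabilizer_amalgamVertex (i : ι) (g : PushoutI φ) (x : V i) :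
    MulAction.stabilizer (PushoutI φ) (amalgamVertex φ i g x) =
      ((MulAction.stabilizer (H i) x).map (PushoutI.of i)).map (MulAut.conj g).toMonoidHom := by
  rw [← Induced.stabilizer_mk]
  ext k
  rw [MulAction.mem_stabilizer_iff, MulAction.mem_stabilizer_iff, smul_amalgamVertex,
    Induced.smul_mk]
  exact ⟨fun h => eq_of_heq (Sigma.mk.inj h).2, fun h => congrArg (Sigma.mk i) h⟩

theorem stabilizer_amalgamVertex_one (i : ι) (x : V i) :
    MulAction.stabilizer (PushoutI φ) (amalgamVertex φ i 1 x) =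
      (MulAction.stabilizer (H i) x).map (PushoutI.of i) := by
  rw [stabilizer_amalgamVertex, map_one]
  exact Subgroup.map_id _

/-- The edges of the graph of the amalgam: the translates of the edges of the graphs of the factors,
and the translates of the edges between the base vertices of the different factors. -/
inductive AmalgamRel (φ : ∀ i, K →* H i) (X : ∀ i, SimpleGraph (V i)) (p : ∀ i, V i) :
    AmalgamVertex φ V → AmalgamVertex φ V → Prop
  | block (i : ι) (g : PushoutI φ) (x y : V i) (h : (X i).Adj x y) :
      AmalgamRel φ X p (amalgamVertex φ i g x) (amalgamVertex φ i g y)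
  | cross (i j : ι) (g : PushoutI φ) (h : i ≠ j) :
      AmalgamRel φ X p (amalgamVertex φ i g (p i)) (amalgamVertex φ j g (p j))

/-- The graph of the amalgam: the translates of the graphs of the factors, joined in a tree-like
manner along the translates of the base vertices. -/
def amalgamGraph (φ : ∀ i, K →* H i) (X : ∀ i, SimpleGraph (V i)) (p : ∀ i, V i) :
    SimpleGraph (AmalgamVertex φ V) where
  Adj a b := a ≠ b ∧ AmalgamRel φ X p a b
  symm := ⟨by
    rintro a b ⟨hne, h⟩
    refine ⟨hne.symm, ?_⟩
    cases h with
    | block i g x y h => exact .block i g y x h.symm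
    | cross i j g h => exact .cross j i g h.symm⟩
  loopless := ⟨fun a h => h.1 rfl⟩

variable {X : ∀ i, SimpleGraph (V i)} {p : ∀ i, V i}

theorem adj_block (hφ : ∀ i, Function.Injective (φ i)) (i : ι) (g : PushoutI φ) {x y : V i}
    (h : (X i).Adj x y) :
    (amalgamGraph φ X p).Adj (amalgamVertex φ i g x) (amalgamVertex φ i g y) :=
  ⟨fun e => h.ne (amalgamVertex_injective hφ i g e), .block i g x y h⟩

theorem adj_cross (i j : ι) (g : PushoutI φ) (h : i ≠ j) :
    (amalgamGraph φ X p).Adj (amalgamVertex φ i g (p i)) (amalgamVertex φ j g (p j)) :=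
  ⟨fun e => h (congrArg Sigma.fst e), .cross i j g h⟩

theorem amalgamGraph_adj_smul (k : PushoutI φ) {a b : AmalgamVertex φ V}
    (h : (amalgamGraph φ X p).Adj a b) : (amalgamGraph φ X p).Adj (k • a) (k • b) := by
  refine ⟨fun e => h.1 (MulAction.injective k e), ?_⟩
  obtain ⟨-, h⟩ := h
  cases h with
  | block i g x y h => exact .block i (k * g) x y h
  | cross i j g h => exact .cross i j (k * g) h

theorem reachable_block (hφ : ∀ i, Function.Injective (φ i)) (hX : ∀ i, (X i).Connected) (i : ι)
    (g : PushoutI φ) (x y : V i) :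
    (amalgamGraph φ X p).Reachable (amalgamVertex φ i g x) (amalgamVertex φ i g y) := by
  let f : X i →g amalgamGraph φ X p := ⟨fun z => amalgamVertex φ i g z, adj_block hφ i g⟩
  exact ((hX i).preconnected x y).map f

theorem reachable_cross (i j : ι) (g : PushoutI φ) :
    (amalgamGraph φ X p).Reachable (amalgamVertex φ i g (p i)) (amalgamVertex φ j g (p j)) := by
  by_cases h : i = j
  · subst h
    exact .refl _
  · exact (adj_cross i j g h).reachable

theorem amalgamGraph_connected [Nonempty ι] (hφ : ∀ i, Function.Injective (φ i))
    (hX : ∀ i, (X i).Connected) : (amalgamGraph φ X p).Connected := by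
  let o := Classical.arbitrary ι
  have key : ∀ g, (amalgamGraph φ X p).Reachable (amalgamVertex φ o 1 (p o))
      (amalgamVertex φ o g (p o)) := by
    intro g
    induction g using pushout_right_induction with
    | one => exact .refl _
    | mul g i h ih =>
      refine ((ih.trans (reachable_cross o i g)).trans
        (reachable_block hφ hX i g (p i) (h • p i))).trans ?_
      rw [← amalgamVertex_mul]
      exact reachable_cross i o _
  have key' : ∀ a, (amalgamGraph φ X p).Reachable (amalgamVertex φ o 1 (p o)) a := by
    intro a
    obtain ⟨i, g, x, rfl⟩ := exists_amalgamVertex a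
    exact ((key g).trans (reachable_cross o i g)).trans (reachable_block hφ hX i g _ x)
  have : Nonempty (AmalgamVertex φ V) := ⟨amalgamVertex φ o 1 (p o)⟩
  exact ⟨fun a b => (key' a).symm.trans (key' b)⟩

/-- `pr` is the gate map of the amalgam graph onto the graph of the `i`-th factor, with `r` the
projection of the amalgam onto the orbit of the base vertex. -/
structure IsBlockProjection (φ : ∀ i, K →* H i) (i : ι) (r : PushoutI φ → V i)
    (pr : AmalgamVertex φ V → V i) : Prop where
  of_self : ∀ (a : H i) (x : V i), pr (amalgamVertex φ i (PushoutI.of i a) x) = a • x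
  of_notMem : ∀ (g : PushoutI φ) (x : V i), g ∉ (PushoutI.of (φ := φ) i).range →
    pr (amalgamVertex φ i g x) = r g
  of_ne : ∀ (j : ι) (g : PushoutI φ) (x : V j), j ≠ i → pr (amalgamVertex φ j g x) = r g

theorem exists_isBlockProjection (hφ : ∀ i, Function.Injective (φ i)) (i : ι)
    {r : PushoutI φ → V i} (hr : IsProjection i (p i) r) :
    ∃ pr, IsBlockProjection φ i r pr := by
  classical
  have h : ∀ a : AmalgamVertex φ V, ∃ y : V i,
      (∀ (c : H i) (x : V i), a = amalgamVertex φ i (PushoutI.of i c) x → y = c • x) ∧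
      (∀ (g : PushoutI φ) (x : V i), a = amalgamVertex φ i g x →
        g ∉ (PushoutI.of (φ := φ) i).range → y = r g) ∧
      ∀ (j : ι) (g : PushoutI φ) (x : V j), a = amalgamVertex φ j g x → j ≠ i → y = r g := by
    intro a
    obtain ⟨j, g, x, rfl⟩ := exists_amalgamVertex a
    by_cases hj : j = i
    · subst hj
      by_cases hg : g ∈ (PushoutI.of (φ := φ) j).range
      · obtain ⟨c, rfl⟩ := hg
        refine ⟨c • x, fun d y hd => ?_, fun g y hgy hg => ?_, fun j' g y hgy hj' => ?_⟩
        · obtain ⟨h, h1, h2⟩ := amalgamVertex_eq_iff.1 hd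
          rw [← map_mul] at h1
          rw [PushoutI.of_injective hφ j h1, h2, mul_smul]
        · obtain ⟨h, h1, h2⟩ := amalgamVertex_eq_iff.1 hgy
          exact absurd ⟨c * h, by rw [h1, map_mul]⟩ hg
        · exact absurd (congrArg Sigma.fst hgy).symm hj'
      · refine ⟨r g, fun d y hd => ?_, fun g' y hgy hg' => ?_, fun j' g y hgy hj' => ?_⟩
        · obtain ⟨h, h1, h2⟩ := amalgamVertex_eq_iff.1 hd
          exact absurd ⟨d * h⁻¹, by rw [map_mul, h1, mul_assoc, ← map_mul]; simp⟩ hg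
        · obtain ⟨h, h1, h2⟩ := amalgamVertex_eq_iff.1 hgy
          rw [h1, hr.mul_of_notMem g h hg]
        · exact absurd (congrArg Sigma.fst hgy).symm hj'
    · refine ⟨r g, fun d y hd => ?_, fun g' y hgy hg' => ?_, fun j' g' y hgy hj' => ?_⟩
      · exact absurd (congrArg Sigma.fst hd) hj
      · exact absurd (congrArg Sigma.fst hgy) hj
      · obtain rfl : j = j' := congrArg Sigma.fst hgy
        obtain ⟨h, h1, h2⟩ := amalgamVertex_eq_iff.1 hgy
        rw [h1, hr.mul_of_ne g j h hj]
  choose pr h1 h2 h3 using h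
  exact ⟨pr, fun a x => h1 _ a x rfl, fun g x hg => h2 _ g x rfl hg,
    fun j g x hj => h3 _ j g x rfl hj⟩

namespace IsBlockProjection

variable {i : ι} {r : PushoutI φ → V i} {pr : AmalgamVertex φ V → V i}

theorem one (hpr : IsBlockProjection φ i r pr) (x : V i) : pr (amalgamVertex φ i 1 x) = x := by
  simpa using hpr.of_self 1 x

theorem base_vertex (hpr : IsBlockProjection φ i r pr) (hr : IsProjection i (p i) r) (j : ι)
    (g : PushoutI φ) : pr (amalgamVertex φ j g (p j)) = r g := by
  by_cases hj : j = i
  · subst hj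
    by_cases hg : g ∈ (PushoutI.of (φ := φ) j).range
    · obtain ⟨c, rfl⟩ := hg
      rw [hpr.of_self, hr.of_self]
    · exact hpr.of_notMem g _ hg
  · exact hpr.of_ne j g _ hj

/-- Every translate of the graph of a factor is a block of the graph of the amalgam. -/
theorem isGate (hφ : ∀ i, Function.Injective (φ i))
    (hX : ∀ (a : H i) x y, (X i).Adj x y → (X i).Adj (a • x) (a • y))
    (hpr : IsBlockProjection φ i r pr) (hr : IsProjection i (p i) r) (g : PushoutI φ) :
    IsGate (amalgamGraph φ X p) (X i) (amalgamVertex φ i g) (fun a => pr (g⁻¹ • a)) where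
  pr_emb x := by rw [smul_amalgamVertex, inv_mul_cancel, hpr.one]
  adj_emb x y h := adj_block hφ i g h
  of_pr_ne := by
    rintro a b ⟨-, h⟩ hne
    cases h with
    | block j k x y h =>
      simp only [smul_amalgamVertex] at hne ⊢
      by_cases hj : j = i
      · subst hj
        by_cases hg : g⁻¹ * k ∈ (PushoutI.of (φ := φ) j).range
        · obtain ⟨c, hc⟩ := hg
          obtain rfl : k = g * PushoutI.of j c := by rw [hc, mul_inv_cancel_left]
          rw [inv_mul_cancel_left, hpr.of_self, hpr.of_self, amalgamVertex_mul, amalgamVertex_mul]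
          exact ⟨hX c x y h, rfl, rfl⟩
        · rw [hpr.of_notMem _ _ hg, hpr.of_notMem _ _ hg] at hne
          exact absurd rfl hne
      · rw [hpr.of_ne _ _ _ hj, hpr.of_ne _ _ _ hj] at hne
        exact absurd rfl hne
    | cross j l k h =>
      simp only [smul_amalgamVertex] at hne
      rw [hpr.base_vertex hr, hpr.base_vertex hr] at hne
      exact absurd rfl hne

/-- A subgroup of a factor that fixes a vertex outside the block of this factor fixes the gate of
that vertex, which is a translate of the base vertex. -/
theorem eq_or_le_stabilizer [Nonempty ι] (hr : IsProjection i (p i) r) {L : Subgroup (H i)}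
    {a : AmalgamVertex φ V} (hL : L.map (PushoutI.of i) ≤ MulAction.stabilizer (PushoutI φ) a)
    (hpr : IsBlockProjection φ i r pr) :
    (∃ x, a = amalgamVertex φ i 1 x) ∨ ∃ c : H i, L ≤ MulAction.stabilizer (H i) (c • p i) := by
  obtain ⟨j, g, x, rfl⟩ := exists_amalgamVertex a
  have key : (∀ l : H i, pr (amalgamVertex φ j (PushoutI.of i l * g) x) =
      r (PushoutI.of i l * g)) → ∃ c : H i, L ≤ MulAction.stabilizer (H i) (c • p i) := by
    intro h
    obtain ⟨c, hc⟩ := hr.exists_smul g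
    refine ⟨c, fun l hl => ?_⟩
    have h1 : PushoutI.of i l • amalgamVertex φ j g x = amalgamVertex φ j g x :=
      hL (Subgroup.mem_map_of_mem _ hl)
    rw [smul_amalgamVertex] at h1
    have h2 := h l
    have h3 := h 1
    rw [map_one, one_mul] at h3
    rw [h1, h3, hr.of_mul, hc] at h2
    exact h2.symm
  by_cases hj : j = i
  · subst hj
    by_cases hg : g ∈ (PushoutI.of (φ := φ) j).range
    · obtain ⟨c, rfl⟩ := hg
      refine Or.inl ⟨c • x, ?_⟩
      rw [← amalgamVertex_mul, one_mul]
    · exact Or.inr (key fun l => hpr.of_notMem _ _ fun h =>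
        hg ((Subgroup.mul_mem_cancel_left _ (MonoidHom.mem_range.2 ⟨_, rfl⟩)).1 h))
  · exact Or.inr (key fun l => hpr.of_ne _ _ _ hj)

end IsBlockProjection

/-- The standing data on the graph of an amalgam: equivariant graphs of the factors with base
vertices that are stabilized exactly by the amalgamated subgroup, and the resulting gate maps. -/
structure HasBlocks (φ : ∀ i, K →* H i) (X : ∀ i, SimpleGraph (V i)) (p : ∀ i, V i)
    (r : ∀ i, PushoutI φ → V i) (pr : ∀ i, AmalgamVertex φ V → V i) : Prop where
  injective : ∀ i, Function.Injective (φ i)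
  adj_smul : ∀ i (a : H i) x y, (X i).Adj x y → (X i).Adj (a • x) (a • y)
  stabilizer_base : ∀ i, MulAction.stabilizer (H i) (p i) = (φ i).range
  isProjection : ∀ i, IsProjection i (p i) (r i)
  isBlockProjection : ∀ i, IsBlockProjection φ i (r i) (pr i)

theorem exists_hasBlocks [Nonempty ι] (hφ : ∀ i, Function.Injective (φ i))
    (hX : ∀ i (a : H i) x y, (X i).Adj x y → (X i).Adj (a • x) (a • y))
    (hp : ∀ i, MulAction.stabilizer (H i) (p i) = (φ i).range) :
    ∃ r pr, HasBlocks φ X p r pr := by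
  choose r hr using fun i => exists_isProjection (i := i) hφ (p i) (hp i).ge
  choose pr hpr using fun i => exists_isBlockProjection hφ i (hr i)
  exact ⟨r, pr, hφ, hX, hp, hr, hpr⟩

namespace HasBlocks

variable {r : ∀ i, PushoutI φ → V i} {pr : ∀ i, AmalgamVertex φ V → V i}

theorem isGate (h : HasBlocks φ X p r pr) (i : ι) (g : PushoutI φ) :
    IsGate (amalgamGraph φ X p) (X i) (amalgamVertex φ i g) (fun a => pr i (g⁻¹ • a)) :=
  (h.isBlockProjection i).isGate h.injective (h.adj_smul i) (h.isProjection i) g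

/-- The neighbour of a base vertex across an edge of the amalgamation does not depend on the
translate that represents the base vertex. -/
theorem base_congr (h : HasBlocks φ X p r pr) {i j : ι} {g g' : PushoutI φ}
    (hg : amalgamVertex φ i g (p i) = amalgamVertex φ i g' (p i)) :
    amalgamVertex φ j g (p j) = amalgamVertex φ j g' (p j) := by
  obtain ⟨a, h1, h2⟩ := amalgamVertex_eq_iff.1 hg
  have ha : a ∈ MulAction.stabilizer (H i) (p i) := h2.symm
  rw [h.stabilizer_base] at ha
  obtain ⟨c, rfl⟩ := ha
  refine amalgamVertex_eq_iff.2 ⟨φ j c, ?_, ?_⟩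
  · rw [h1, PushoutI.of_apply_eq_base, PushoutI.of_apply_eq_base]
  · have : φ j c ∈ MulAction.stabilizer (H j) (p j) := h.stabilizer_base j ▸ ⟨c, rfl⟩
    exact this.symm

theorem finite_neighbors_same_gate [Finite ι] (h : HasBlocks φ X p r pr) (i : ι) (g : PushoutI φ)
    (x : V i) : {b | (amalgamGraph φ X p).Adj (amalgamVertex φ i g x) b ∧
      pr i (g⁻¹ • b) = pr i (g⁻¹ • amalgamVertex φ i g x)}.Finite := by
  have hfin : ∀ j : ι, {b | ∃ k : PushoutI φ, amalgamVertex φ i g x = amalgamVertex φ i k (p i) ∧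
      b = amalgamVertex φ j k (p j)}.Finite := by
    intro j
    refine Set.Subsingleton.finite ?_
    rintro b ⟨k, hk, rfl⟩ b' ⟨k', hk', rfl⟩
    exact h.base_congr (hk.symm.trans hk')
  refine (Set.finite_iUnion hfin).subset ?_
  rintro b ⟨⟨-, hadj⟩, hb⟩
  generalize ha : amalgamVertex φ i g x = a at hadj hb
  cases hadj with
  | block j k y z hyz =>
    obtain rfl : i = j := congrArg Sigma.fst ha
    obtain ⟨c, rfl, rfl⟩ := amalgamVertex_eq_iff.1 ha
    rw [amalgamVertex_mul, amalgamVertex_mul] at hb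
    have h1 := (h.isGate i g).pr_emb
    rw [h1, h1] at hb
    exact absurd (MulAction.injective c hb).symm hyz.ne
  | cross j l k hjl =>
    obtain rfl : i = j := congrArg Sigma.fst ha
    exact Set.mem_iUnion.2 ⟨l, k, rfl, rfl⟩

theorem isFine [Finite ι] (h : HasBlocks φ X p r pr) (hfine : ∀ i, IsFine (X i)) :
    IsFine (amalgamGraph φ X p) := by
  choose i g x hgx using fun a : AmalgamVertex φ V => exists_amalgamVertex a
  refine isFine_of_gates (fun a => X (i a)) (fun a => amalgamVertex φ (i a) (g a))
    (fun a b => pr (i a) ((g a)⁻¹ • b)) (fun a => h.isGate (i a) (g a))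
    (fun a => hfine (i a)) (fun a => ?_) fun a => ?_
  · have h1 := (h.isGate (i a) (g a)).pr_emb (x a)
    rw [← hgx a] at h1
    exact (congrArg _ h1).trans (hgx a).symm
  · have h1 := h.finite_neighbors_same_gate (i a) (g a) (x a)
    rwa [← hgx a] at h1

/-- The gate maps separate vertices at distance at least two. -/
theorem exists_pr_ne [Nonempty ι] (h : HasBlocks φ X p r pr) {a b : AmalgamVertex φ V}
    (hab : 2 ≤ (amalgamGraph φ X p).dist a b) :
    ∃ k : PushoutI φ × ι, pr k.2 (k.1⁻¹ • a) ≠ pr k.2 (k.1⁻¹ • b) := by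
  by_contra! hcon
  have hcon' : ∀ g i, pr i (g⁻¹ • a) = pr i (g⁻¹ • b) := fun g i => hcon (g, i)
  obtain ⟨i, g, x, rfl⟩ := exists_amalgamVertex a
  -- a point outside the block of `a` with the same gate makes `a` a translate of the base vertex
  have key : (∃ g', amalgamVertex φ i g x = amalgamVertex φ i g' (p i)) := by
    obtain ⟨j, k, y, rfl⟩ := exists_amalgamVertex b
    have h1 := hcon' g i
    rw [smul_amalgamVertex, smul_amalgamVertex, inv_mul_cancel,
      (h.isBlockProjection i).one] at h1
    have hout : pr i (amalgamVertex φ j (g⁻¹ * k) y) = r i (g⁻¹ * k) →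
        ∃ g', amalgamVertex φ i g x = amalgamVertex φ i g' (p i) := by
      intro h2
      obtain ⟨c, hc⟩ := (h.isProjection i).exists_smul (g⁻¹ * k)
      exact ⟨g * PushoutI.of i c, by rw [amalgamVertex_mul, h1, h2, hc]⟩
    by_cases hj : j = i
    · subst hj
      by_cases hg : g⁻¹ * k ∈ (PushoutI.of (φ := φ) j).range
      · obtain ⟨c, hc⟩ := hg
        obtain rfl : k = g * PushoutI.of j c := by rw [hc, mul_inv_cancel_left]
        rw [inv_mul_cancel_left, (h.isBlockProjection j).of_self] at h1
        rw [amalgamVertex_mul, ← h1, SimpleGraph.dist_self] at hab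
        omega
      · exact hout ((h.isBlockProjection j).of_notMem _ _ hg)
    · exact hout ((h.isBlockProjection i).of_ne _ _ _ hj)
  obtain ⟨g', hg'⟩ := key
  rw [hg'] at hcon' hab
  obtain ⟨j, k, y, rfl⟩ := exists_amalgamVertex b
  have h1 : ∀ l, pr l (amalgamVertex φ j (g'⁻¹ * k) y) = p l := by
    intro l
    have h2 := hcon' g' l
    rw [smul_amalgamVertex, smul_amalgamVertex, inv_mul_cancel,
      (h.isBlockProjection l).base_vertex (h.isProjection l), (h.isProjection l).one] at h2
    exact h2.symm
  by_cases hg : g'⁻¹ * k ∈ (PushoutI.of (φ := φ) j).range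
  · obtain ⟨c, hc⟩ := hg
    obtain rfl : k = g' * PushoutI.of j c := by rw [hc, mul_inv_cancel_left]
    have h2 := h1 j
    rw [inv_mul_cancel_left, (h.isBlockProjection j).of_self] at h2
    rw [amalgamVertex_mul, h2] at hab
    by_cases hij : i = j
    · subst hij
      rw [SimpleGraph.dist_self] at hab
      omega
    · rw [SimpleGraph.dist_eq_one_iff_adj.2 (adj_cross i j g' hij)] at hab
      omega
  · have h2 := mem_base_of_projections h.stabilizer_base h.isProjection (g'⁻¹ * k) fun l => by
      rw [← h1 l]
      by_cases hjl : j = l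
      · subst hjl
        exact ((h.isBlockProjection j).of_notMem _ _ hg).symm
      · exact ((h.isBlockProjection l).of_ne _ _ _ hjl).symm
    obtain ⟨c, hc⟩ := h2
    exact hg ⟨φ j c, by rw [PushoutI.of_apply_eq_base, hc]⟩

theorem isHyperbolic [Finite ι] [Nonempty ι] (h : HasBlocks φ X p r pr)
    (hconn : ∀ i, (X i).Connected) (hhyp : ∀ i, IsHyperbolicGraph (X i)) :
    IsHyperbolicGraph (amalgamGraph φ X p) := by
  choose δ hδ using hhyp
  obtain ⟨Δ, hΔ⟩ := (Set.finite_range δ).bddAbove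
  refine ⟨max Δ 2, fun x y z t => ?_⟩
  exact (FourPoint.of_gates (K := PushoutI φ × ι) (fun k => h.isGate k.2 k.1)
    (amalgamGraph_connected h.injective hconn) (fun k => hconn k.2)
    (fun k a b c d => (fourPoint_of_forall (hδ k.2) a b c d).mono (hΔ ⟨k.2, rfl⟩))
    (fun a b hab => h.exists_pr_ne hab) x y z t).1

end HasBlocks

end AmalgamGraph

/-! ### Topology of the amalgam and Cayley-Abels graphs -/

/-- A topological group with an open TDLC subgroup is TDLC. -/
theorem IsTDLC.of_isOpenEmbedding {A : Type u} {G : Type v} [Group A] [TopologicalSpace A] [Group G]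
    [TopologicalSpace G] [IsTopologicalGroup G] (hA : IsTDLC A) {f : A →* G}
    (hf : Topology.IsOpenEmbedding f) : IsTDLC G := by
  have := hA.isTopologicalGroup
  have := hA.t2Space
  have := hA.locallyCompactSpace
  have := hA.totallyDisconnectedSpace
  have hopen : IsOpen (f.range : Set G) := by
    rw [MonoidHom.coe_range]
    exact hf.isOpen_range
  have hclosed : IsClosed (f.range : Set G) := Subgroup.isClosed_of_isOpen _ hopen
  have hcl : Topology.IsClosedEmbedding f :=
    ⟨hf.isEmbedding, by rwa [MonoidHom.coe_range] at hclosed⟩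
  have ht1 : T1Space G := by
    refine IsTopologicalGroup.t1Space G ?_
    simpa using hcl.isClosedMap {1} isClosed_singleton
  refine ⟨inferInstance, inferInstance, ?_, ⟨?_⟩⟩
  · obtain ⟨K, hK, hK1⟩ := exists_compact_mem_nhds (1 : A)
    refine (hK.image hf.continuous).locallyCompactSpace_of_mem_nhds_of_group (x := 1) ?_
    have := hf.isOpenMap.image_mem_nhds hK1
    rwa [map_one] at this
  · intro S _ hS x hx y hy
    have hS' : IsPreconnected ((fun z => x⁻¹ * z) '' S) :=
      hS.image _ (continuous_const_mul x⁻¹).continuousOn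
    have hsub : (fun z => x⁻¹ * z) '' S ⊆ f.range :=
      hS'.subset_isClopen ⟨hclosed, hopen⟩ ⟨1, ⟨x, hx, by simp⟩, one_mem _⟩
    have heq : f '' (f ⁻¹' ((fun z => x⁻¹ * z) '' S)) = (fun z => x⁻¹ * z) '' S :=
      Set.image_preimage_eq_of_subset hsub
    rw [← heq, hf.isInducing.isPreconnected_image] at hS'
    have hss := hS'.subsingleton
    obtain ⟨a, ha⟩ := hsub ⟨y, hy, rfl⟩
    have h1 : a = 1 := hss (by rw [Set.mem_preimage, ha]; exact ⟨y, hy, rfl⟩)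
      (by rw [Set.mem_preimage, map_one]; exact ⟨x, hx, by simp⟩)
    rw [h1, map_one] at ha
    exact (inv_mul_eq_one.1 ha.symm)

namespace HasBlocks

variable {ι : Type} {H : ι → Type u} {K : Type v} [∀ i, Group (H i)] [Group K]
  {φ : ∀ i, K →* H i} {V : ι → Type u} [∀ i, MulAction (H i) (V i)]
  {X : ∀ i, SimpleGraph (V i)} {p : ∀ i, V i}
  {r : ∀ i, PushoutI φ → V i} {pr : ∀ i, AmalgamVertex φ V → V i}
  {ℋ : ∀ i, Set (Subgroup (H i))} [∀ i, TopologicalSpace (H i)]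

/-- A non-compact open subgroup of a factor only fixes vertices in the block of this factor. -/
theorem eq_of_map_le_stabilizer [Nonempty ι] [∀ i, IsTopologicalGroup (H i)]
    (h : HasBlocks φ X p r pr)
    (hC : ∀ i, IsCompact ((φ i).range : Set (H i))) {i : ι} {L : Subgroup (H i)}
    (hLo : IsOpen (L : Set (H i))) (hLc : ¬ IsCompact (L : Set (H i))) {a : AmalgamVertex φ V}
    (hL : L.map (PushoutI.of i) ≤ MulAction.stabilizer (PushoutI φ) a) :
    ∃ x, a = amalgamVertex φ i 1 x := by
  refine ((h.isBlockProjection i).eq_or_le_stabilizer (h.isProjection i) hL).resolve_right ?_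
  rintro ⟨c, hc⟩
  have hcomp : IsCompact (MulAction.stabilizer (H i) (p i) : Set (H i)) := by
    rw [h.stabilizer_base]
    exact hC i
  exact hLc ((isCompact_stabilizer_smul hcomp c).of_isClosed_subset
    (Subgroup.isClosed_of_isOpen _ hLo) hc)

variable [TopologicalSpace (PushoutI φ)]

theorem isCompact_map_iff {i : ι} (hof : Topology.IsOpenEmbedding (PushoutI.of (φ := φ) i))
    (L : Subgroup (H i)) : IsCompact (L.map (PushoutI.of (φ := φ) i) : Set (PushoutI φ)) ↔
      IsCompact (L : Set (H i)) := by
  rw [Subgroup.coe_map, ← hof.isInducing.isCompact_iff]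

variable [IsTopologicalGroup (PushoutI φ)]

theorem isOpen_stabilizer {i : ι} (hof : Topology.IsOpenEmbedding (PushoutI.of (φ := φ) i))
    {x : V i} (hx : IsOpen (MulAction.stabilizer (H i) x : Set (H i))) (g : PushoutI φ) :
    IsOpen (MulAction.stabilizer (PushoutI φ) (amalgamVertex φ i g x) : Set (PushoutI φ)) := by
  rw [← mul_one g, ← smul_amalgamVertex]
  refine isOpen_stabilizer_smul ?_ g
  rw [stabilizer_amalgamVertex_one]
  exact hof.isOpenMap _ hx

theorem isCompact_stabilizer {i : ι} (hof : Topology.IsOpenEmbedding (PushoutI.of (φ := φ) i))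
    {x : V i} (hx : IsCompact (MulAction.stabilizer (H i) x : Set (H i))) (g : PushoutI φ) :
    IsCompact (MulAction.stabilizer (PushoutI φ) (amalgamVertex φ i g x) : Set (PushoutI φ)) := by
  rw [← mul_one g, ← smul_amalgamVertex]
  refine isCompact_stabilizer_smul ?_ g
  rw [stabilizer_amalgamVertex_one]
  exact (isCompact_map_iff hof _).2 hx

theorem isCompact_edgeStabilizer (h : HasBlocks φ X p r pr)
    (hof : ∀ i, Topology.IsOpenEmbedding (PushoutI.of (φ := φ) i))
    (hC : ∀ i, IsCompact ((φ i).range : Set (H i))) (hCA : ∀ i, IsCayleyAbelsGraph (ℋ i) (X i))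
    {a b : AmalgamVertex φ V} (hab : (amalgamGraph φ X p).Adj a b) :
    IsCompact (edgeStabilizer (PushoutI φ) a b) := by
  have hopen : ∀ a : AmalgamVertex φ V,
      IsOpen (MulAction.stabilizer (PushoutI φ) a : Set (PushoutI φ)) := by
    intro a
    obtain ⟨i, g, x, rfl⟩ := exists_amalgamVertex a
    exact isOpen_stabilizer (hof i) ((hCA i).isOpen_stabilizer x) g
  have hclosed := isClosed_edgeStabilizer (hopen a) (hopen b)
  obtain ⟨-, hab⟩ := hab
  cases hab with
  | block i g x y hxy =>
    have hc : Continuous fun c : H i => g * PushoutI.of i c * g⁻¹ := by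
      have := (hof i).continuous
      fun_prop
    refine (((hCA i).isCompact_edge x y hxy).image hc).of_isClosed_subset hclosed fun k hk => ?_
    rw [edgeStabilizer, Set.mem_ofPred_eq, smul_amalgamVertex, smul_amalgamVertex] at hk
    have hc : ∃ c : H i, k * g = g * PushoutI.of i c := by
      rcases Sym2.eq_iff.1 hk with ⟨h1, -⟩ | ⟨h1, -⟩ <;>
      · obtain ⟨c, hc, -⟩ := amalgamVertex_eq_iff.1 h1
        exact ⟨c⁻¹, by rw [map_inv, eq_mul_inv_iff_mul_eq, ← hc]⟩
    obtain ⟨c, hc⟩ := hc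
    refine ⟨c, ?_, by simp only [← hc, mul_inv_cancel_right]⟩
    rw [hc, amalgamVertex_mul, amalgamVertex_mul, ← Sym2.map_mk, ← Sym2.map_mk (b := y)] at hk
    exact Sym2.map.injective (amalgamVertex_injective h.injective i g) hk
  | cross i j g hij =>
    have hcomp : IsCompact (MulAction.stabilizer (H i) (p i) : Set (H i)) := by
      rw [h.stabilizer_base]
      exact hC i
    refine (isCompact_stabilizer (hof i) hcomp g).of_isClosed_subset hclosed fun k hk => ?_
    rcases Sym2.eq_iff.1 hk with ⟨h1, -⟩ | ⟨h1, -⟩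
    · exact h1
    · exact absurd (congrArg Sigma.fst h1) hij

variable [∀ i, IsTopologicalGroup (H i)]

theorem isCayleyAbelsGraph [Finite ι] [Nonempty ι] (h : HasBlocks φ X p r pr)
    (hof : ∀ i, Topology.IsOpenEmbedding (PushoutI.of (φ := φ) i))
    (hC : ∀ i, IsCompact ((φ i).range : Set (H i))) (hCA : ∀ i, IsCayleyAbelsGraph (ℋ i) (X i)) :
    IsCayleyAbelsGraph (⋃ i, Subgroup.map (PushoutI.of (φ := φ) i) '' ℋ i)
      (amalgamGraph φ X p) where
  adj_smul k a b hab := amalgamGraph_adj_smul k hab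
  connected := amalgamGraph_connected h.injective fun i => (hCA i).connected
  finite_vertex_orbits := by
    choose F hF hF' using fun i => (hCA i).finite_vertex_orbits
    refine ⟨⋃ i, amalgamVertex φ i 1 '' F i, Set.finite_iUnion fun i => (hF i).image _,
      fun a => ?_⟩
    obtain ⟨i, g, x, rfl⟩ := exists_amalgamVertex a
    obtain ⟨c, hc⟩ := hF' i x
    refine ⟨PushoutI.of i c * g⁻¹, Set.mem_iUnion.2 ⟨i, c • x, hc, ?_⟩⟩
    rw [smul_amalgamVertex, inv_mul_cancel_right, ← amalgamVertex_mul, one_mul]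
  finite_edge_orbits := by
    choose F hF hF' using fun i => (hCA i).finite_edge_orbits
    refine ⟨(⋃ i, (fun e : V i × V i => (amalgamVertex φ i 1 e.1, amalgamVertex φ i 1 e.2)) '' F i) ∪
      Set.range fun e : ι × ι => (amalgamVertex φ e.1 1 (p e.1), amalgamVertex φ e.2 1 (p e.2)),
      (Set.finite_iUnion fun i => (hF i).image _).union (Set.finite_range _), ?_⟩
    rintro a b ⟨-, hab⟩
    cases hab with
    | block i g x y hxy =>
      obtain ⟨c, hc⟩ := hF' i x y hxy
      refine ⟨PushoutI.of i c * g⁻¹, Or.inl (Set.mem_iUnion.2 ⟨i, _, hc, ?_⟩)⟩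
      simp only [smul_amalgamVertex, inv_mul_cancel_right, ← amalgamVertex_mul, one_mul]
    | cross i j g hij =>
      refine ⟨g⁻¹, Or.inr ⟨(i, j), ?_⟩⟩
      simp only [smul_amalgamVertex, inv_mul_cancel]
  isOpen_stabilizer a := by
    obtain ⟨i, g, x, rfl⟩ := exists_amalgamVertex a
    exact isOpen_stabilizer (hof i) ((hCA i).isOpen_stabilizer x) g
  isCompact_edge a b hab := h.isCompact_edgeStabilizer hof hC hCA hab
  vertex_stabilizer a := by
    obtain ⟨i, g, x, rfl⟩ := exists_amalgamVertex a
    rcases (hCA i).vertex_stabilizer x with hx | ⟨L, hL, c, hc⟩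
    · exact Or.inl (isCompact_stabilizer (hof i) hx g)
    · refine Or.inr ⟨L.map (PushoutI.of i), Set.mem_iUnion.2 ⟨i, L, hL, rfl⟩,
        g * PushoutI.of i c, ?_⟩
      rw [stabilizer_amalgamVertex, hc, Subgroup.map_map, Subgroup.map_map, Subgroup.map_map]
      congr 1
      ext l
      simp [mul_assoc]
  exists_vertex L hL := by
    obtain ⟨i, L, hLi, rfl⟩ := Set.mem_iUnion.1 hL
    obtain ⟨x, rfl⟩ := (hCA i).exists_vertex L hLi
    exact ⟨amalgamVertex φ i 1 x, stabilizer_amalgamVertex_one i x⟩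
  same_orbit L hL hLc a b ha hb := by
    obtain ⟨i, L, hLi, rfl⟩ := Set.mem_iUnion.1 hL
    rw [isCompact_map_iff (hof i)] at hLc
    have hLo : IsOpen (L : Set (H i)) := by
      obtain ⟨x, rfl⟩ := (hCA i).exists_vertex L hLi
      exact (hCA i).isOpen_stabilizer x
    have hinj := Subgroup.map_injective (PushoutI.of_injective h.injective i)
    obtain ⟨x, rfl⟩ := h.eq_of_map_le_stabilizer hC hLo hLc ha.ge
    obtain ⟨y, rfl⟩ := h.eq_of_map_le_stabilizer hC hLo hLc hb.ge
    rw [stabilizer_amalgamVertex_one] at ha hb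
    obtain ⟨c, rfl⟩ := (hCA i).same_orbit L hLi hLc x y (hinj ha) (hinj hb)
    exact ⟨PushoutI.of i c, by rw [smul_amalgamVertex, mul_one, ← amalgamVertex_mul, one_mul]⟩

theorem isProperPair [Finite ι] [Nonempty ι] (h : HasBlocks φ X p r pr)
    (hof : ∀ i, Topology.IsOpenEmbedding (PushoutI.of (φ := φ) i))
    (hC : ∀ i, IsCompact ((φ i).range : Set (H i))) (hCA : ∀ i, IsCayleyAbelsGraph (ℋ i) (X i))
    (hℋ : ∀ i, IsProperPair (ℋ i)) :
    IsProperPair (⋃ i, Subgroup.map (PushoutI.of (φ := φ) i) '' ℋ i) where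
  isTDLC := (hℋ (Classical.arbitrary ι)).isTDLC.of_isOpenEmbedding (hof _)
  finite := Set.finite_iUnion fun i => (hℋ i).finite.image _
  isOpen L hL := by
    obtain ⟨i, L, hLi, rfl⟩ := Set.mem_iUnion.1 hL
    exact (hof i).isOpenMap _ ((hℋ i).isOpen L hLi)
  eq_of_conj L hL M hM hLc hMc hLM := by
    obtain ⟨i, L, hLi, rfl⟩ := Set.mem_iUnion.1 hL
    obtain ⟨j, M, hMj, rfl⟩ := Set.mem_iUnion.1 hM
    rw [isCompact_map_iff (hof _)] at hLc hMc
    obtain ⟨g, hg⟩ := hLM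
    -- the conjugate of `L` fixes a vertex in a translate of the block of `L`, which has to be the
    -- block of `M`
    obtain ⟨x, rfl⟩ := (hCA i).exists_vertex L hLi
    rw [← stabilizer_amalgamVertex] at hg
    obtain ⟨y, hy⟩ := h.eq_of_map_le_stabilizer hC ((hℋ j).isOpen M hMj) hMc hg.le
    obtain rfl : i = j := congrArg Sigma.fst hy
    have hinj := Subgroup.map_injective (PushoutI.of_injective h.injective i)
    rw [hy, stabilizer_amalgamVertex_one] at hg
    obtain rfl := hinj hg
    obtain ⟨c, -, rfl⟩ := amalgamVertex_eq_iff.1 hy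
    rw [(hℋ i).eq_of_conj _ hLi _ hMj hLc hMc ⟨c⁻¹, ?_⟩]
    rw [← MulAction.stabilizer_smul_eq_stabilizer_map_conj, inv_smul_smul]

end HasBlocks

/-- Relative hyperbolicity passes to amalgams of finitely many groups over a compact open
subgroup. -/
theorem isRelHyperbolic_pushout {ι : Type} [Finite ι] [Nonempty ι] {H : ι → Type u} {K : Type v}
    [∀ i, Group (H i)] [Group K] {φ : ∀ i, K →* H i} [∀ i, TopologicalSpace (H i)]
    [TopologicalSpace (PushoutI φ)] [IsTopologicalGroup (PushoutI φ)]
    {ℋ : ∀ i, Set (Subgroup (H i))} (hφ : ∀ i, Function.Injective (φ i))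
    (hof : ∀ i, Topology.IsOpenEmbedding (PushoutI.of (φ := φ) i))
    (hC : ∀ i, IsCompact ((φ i).range : Set (H i))) (hO : ∀ i, IsOpen ((φ i).range : Set (H i)))
    (hℋ : ∀ i, IsRelHyperbolic (ℋ i)) :
    IsRelHyperbolic (⋃ i, Subgroup.map (PushoutI.of (φ := φ) i) '' ℋ i) := by
  have htop : ∀ i, IsTopologicalGroup (H i) := fun i => (hℋ i).1.isTDLC.isTopologicalGroup
  have hex : ∀ i, ∃ (W : Type u) (_ : MulAction (H i) W) (Y : SimpleGraph W),
      IsCayleyAbelsGraph (ℋ i) Y ∧ IsFine Y ∧ IsHyperbolicGraph Y ∧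
        ∃ p : W, MulAction.stabilizer (H i) p = (φ i).range := by
    intro i
    obtain ⟨-, V, _, X, hCA, hfine, hhyp⟩ := hℋ i
    exact exists_cayleyAbels_stabilizer_eq hCA hfine hhyp _ (hC i) (hO i)
  choose V act X hCA hfine hhyp p hp using hex
  obtain ⟨r, pr, h⟩ := exists_hasBlocks (X := X) hφ (fun i => (hCA i).adj_smul) hp
  exact ⟨h.isProperPair hof hC hCA fun i => (hℋ i).1, AmalgamVertex φ V, inferInstance,
    amalgamGraph φ X p, h.isCayleyAbelsGraph hof hC hCA, h.isFine hfine,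
    h.isHyperbolic (fun i => (hCA i).connected) hhyp⟩

instance factorTopology (A B : Type u) [TopologicalSpace A] [TopologicalSpace B] :
    ∀ b, TopologicalSpace (Factor A B b)
  | false => inferInstanceAs (TopologicalSpace A)
  | true => inferInstanceAs (TopologicalSpace B)

end TDLC

open TDLC in
theorem theorem1p1 {A B : Type u} {C : Type v}
    [Group A] [TopologicalSpace A] [Group B] [TopologicalSpace B]
    [Group C] [TopologicalSpace C] [IsTopologicalGroup C] [CompactSpace C]
    (hA : IsTDLC A) (hB : IsTDLC B)
    (iA : C →* A) (iB : C →* B)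
    (hiA : Topology.IsOpenEmbedding iA) (hiB : Topology.IsOpenEmbedding iB)
    (ℋA : Set (Subgroup A)) (ℋB : Set (Subgroup B))
    (hgenA : IsCompactlyGeneratedRel ℋA) (hgenB : IsCompactlyGeneratedRel ℋB)
    (hhypA : IsRelHyperbolic ℋA) (hhypB : IsRelHyperbolic ℋB) :
    IsRelHyperbolic (G := Amalgam iA iB)
      (Subgroup.map (Amalgam.inl iA iB) '' ℋA ∪ Subgroup.map (Amalgam.inr iA iB) '' ℋB) := by
  have := hA.isTopologicalGroup
  have := hB.isTopologicalGroup
  obtain ⟨hG, hl, hr⟩ := Amalgam.topology_spec hiA hiB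
  let ℋ : ∀ b, Set (Subgroup (Factor A B b)) := fun b => match b with
    | false => ℋA
    | true => ℋB
  let _ : TopologicalSpace (Monoid.PushoutI (edgeMap iA iB)) := Amalgam.topology iA iB
  have _ : IsTopologicalGroup (Monoid.PushoutI (edgeMap iA iB)) := hG
  have key := isRelHyperbolic_pushout (φ := edgeMap iA iB) (ℋ := ℋ)
    (Amalgam.edgeMap_injective hiA.injective hiB.injective)
    (by rintro (_ | _); exacts [hl, hr])
    (by
      rintro (_ | _)
      exacts [isCompact_range hiA.continuous, isCompact_range hiB.continuous])
    (by rintro (_ | _); exacts [hiA.isOpen_range, hiB.isOpen_range])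
    (by rintro (_ | _); exacts [hhypA, hhypB])
  have hunion : (⋃ b, Subgroup.map (Monoid.PushoutI.of (φ := edgeMap iA iB) b) '' ℋ b) =
      Subgroup.map (Amalgam.inl iA iB) '' ℋA ∪ Subgroup.map (Amalgam.inr iA iB) '' ℋB := by
    ext L
    rw [Set.mem_iUnion, Bool.exists_bool]
    rfl
  exact hunion ▸ key
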